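/- Let $n\ge 1$, $0\le\epsilon\le\frac12$, and let $f:\{0,1\}^n\to\mathbb R$ be a non-zero function. All expectations are with respect to the uniform measure on $\{0,1\}^n$, and $\|f\|_q=(\mathbb E|f|^q)^{1/q}$. The noise operator is $$(T_\epsilon f)(x)=\sum_{y\in\{0,1\}^n}\epsilon^{|y-x|}(1-\epsilon)^{n-|y-x|}f(y),$$ where $|y-x|$ is the Hamming distance. For a nonnegative function $g$ put $\mathrm{Ent}(g)=\mathbb E\, g\log_2 g-\mathbb E g\,\log_2\mathbb E g$ (with $0\log_2 0=0$), and for $g$ with $\|g\|_1=1$ put $\mathrm{Ent}_2(g)=\log_2\|g\|_2^2$. Let $H(t)=t\log_2\frac1t+(1-t)\log_2\frac1{1-t}$ be the binary entropy function and $H^{-1}:[0,1]\to[0,\frac12]$ its inverse. For $0\le x\le1$ and $0\le\delta\le\frac12$ let $\sigma=H^{-1}(x)$, let $$y=\frac{-\delta^2+\delta\sqrt{\delta^2+4(1-2\delta)\sigma(1-\sigma)}}{2(1-2\delta)}\qquad(\text{and } y=\sigma(1-\sigma)\text{ if }\delta=\tfrac12),$$ $$\Phi(x,\delta)=\tfrac12\Big(x-1+\sigma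 H\big(\tfrac y\sigma\big)+(1-\sigma)H\big(\tfrac y{1-\sigma}\big)+2y\log_2\delta+(1-2y)\log_2(1-\delta)\Big),$$ where $\sigma H(y/\sigma)=0$ if $\sigma=0$ and $2y\log_2\delta=0$ if $\delta=0$. Finally let $\phi_\epsilon(x)=\Phi(x,2\epsilon(1-\epsilon))$ and $q_0=1+(1-2\epsilon)^2$. Then the following hold. 1. Let $x=\frac1n\mathrm{Ent}\big(\frac{|f|}{\|f\|_1}\big)$. Then $\|T_\epsilon f\|_2\le\|f\|_\kappa$ with $\kappa=-\frac{x}{\phi_\epsilon(1-x)}$ if $x\neq0$, and $\kappa=q_0$ if $x=0$. 2. Let $x=\frac1n\mathrm{Ent}_2\big(\frac{f}{\|f\|_1}\big)$. If $\frac{x+1}2\le\frac1{q_0}$, then $\|T_\epsilon f\|_2\le\|f\|_{q_0}$. Otherwise there is a unique $\alpha\in[0,1)$ with $$1-\alpha-\frac{\alpha\,\phi_\epsilon(\alpha)}{1-\alpha}=\frac{x+1}2,$$ and $\|T_\epsilon f\|_2\le\|f\|_\kappa$ with $\kappa=\frac{\alpha-1}{\phi_\epsilon(\alpha)}$. -/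

import Mathlib

open scoped BigOperators

noncomputable section

namespace NoisyCube

/-- The boolean cube `{0,1}ⁿ`. -/
abbrev Cube (n : ℕ) : Type := Fin n → Bool

/-- Expectation with respect to the uniform measure on `{0,1}ⁿ`. -/
def expectation {n : ℕ} (f : Cube n → ℝ) : ℝ :=
  (∑ x : Cube n, f x) / (2 : ℝ) ^ n

/-- The noise operator
`(T_ε f)(x) = ∑_y ε^{|y - x|} (1 - ε)^{n - |y - x|} f(y)`, `|y - x|` the Hamming distance. -/
def noise {n : ℕ} (ε : ℝ) (f : Cube n → ℝ) : Cube n → ℝ := fun x =>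
  ∑ y : Cube n, ε ^ hammingDist y x * (1 - ε) ^ (n - hammingDist y x) * f y

/-- The norm `‖f‖_q = (𝔼 |f|^q)^{1/q}` with respect to the uniform measure (used for `q ≥ 1`). -/
def lqNorm {n : ℕ} (q : ℝ) (f : Cube n → ℝ) : ℝ :=
  (expectation fun x => |f x| ^ q) ^ (1 / q)

/-- The entropy `Ent(g) = 𝔼 g log₂ g - 𝔼 g log₂ 𝔼 g` of a nonnegative function
(`0 log₂ 0 = 0`). -/
def ent {n : ℕ} (g : Cube n → ℝ) : ℝ :=
  (expectation fun x => g x * Real.logb 2 (g x)) - expectation g * Real.logb 2 (expectation g)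

/-- The `q`-th Rényi entropy `Ent_q(g) = (1 / (q - 1)) log₂ ‖g‖_q^q` of a function with
`‖g‖_1 = 1`, for `q > 1`. -/
def renyiEnt {n : ℕ} (q : ℝ) (g : Cube n → ℝ) : ℝ :=
  1 / (q - 1) * Real.logb 2 (lqNorm q g ^ q)

/-- The binary entropy function
`H(t) = t log₂ (1 / t) + (1 - t) log₂ (1 / (1 - t))` (with `H(0) = H(1) = 0`). -/
def H (t : ℝ) : ℝ :=
  t * Real.logb 2 (1 / t) + (1 - t) * Real.logb 2 (1 / (1 - t))

/-- The inverse of `H`, which is a bijection from `[0, 1/2]` onto `[0, 1]`. -/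
def HInv : ℝ → ℝ := Function.invFunOn H (Set.Icc 0 (1 / 2))

/-- The auxiliary quantity `y(x, ε)`, with `σ = H⁻¹(x)`. At `ε = 1/2` the quotient is understood
as its limit `σ (1 - σ)` as `ε → 1/2`. -/
def yAux (x ε : ℝ) : ℝ :=
  if ε = 1 / 2 then HInv x * (1 - HInv x)
  else (-ε ^ 2 + ε * Real.sqrt (ε ^ 2 + 4 * (1 - 2 * ε) * HInv x * (1 - HInv x))) /
    (2 * (1 - 2 * ε))

/-- The function `Φ(x, ε)` on `[0, 1] × [0, 1/2]`
(with the conventions `0 · H(0/0) = 0` and `0 · log₂ 0 = 0` on the boundary). -/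
def Phi (x ε : ℝ) : ℝ :=
  1 / 2 * (x - 1 + HInv x * H (yAux x ε / HInv x) + (1 - HInv x) * H (yAux x ε / (1 - HInv x))
    + 2 * yAux x ε * Real.logb 2 ε + (1 - 2 * yAux x ε) * Real.logb 2 (1 - ε))

/-- `φ_ε(x) = Φ(x, 2 ε (1 - ε))`. -/
def phi (ε x : ℝ) : ℝ := Phi x (2 * ε * (1 - ε))

/-- `q₀ = 1 + (1 - 2ε)²`. -/
def qZero (ε : ℝ) : ℝ := 1 + (1 - 2 * ε) ^ 2

/-- `κ_{2,1}(x, ε) = -x / φ_ε(1 - x)`, extended by its limit `q₀` at `x = 0`, where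
`φ_ε(1) = 0`. -/
def kappaOne (x ε : ℝ) : ℝ :=
  if x = 0 then qZero ε else -x / phi ε (1 - x)

end NoisyCube

end

noncomputable section

namespace NoisyCube

/-! Put `δ = 2ε(1-ε)`. Splitting the cube along one coordinate turns `‖T_ε f‖₂²` into the form
`(1-δ)(u²+v²)+2δuv` in the norms of the two halves, up to Cauchy–Schwarz, so a two-point inequality
against `(u^r+v^r)^(2/r)` tensorizes (`sum_noise_sq_le`).

The best two-point constant is explicit. For fixed `r` the quotient rises and then falls in `t`, and
`critExp δ t` is the exponent whose maximum is at `t`. Parametrize `a = pairEnt δ t`; the maximum is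
then `2^(2Φ(a,δ)+1-2a/r)` (`logQuotient_critExp`, `Phi_pairEnt`), and `Φ` lies below the line of
slope `1/r` through its point at `a`. Hence for each `a` in `[0,1)` some `r` gives `‖T_ε f‖₂ ≤
2^(n(φ_ε(a)+(1-a)/r)) ‖f‖_r`.

Let `s₀ = φ_ε(a)/(a-1)`, where the line of slope `s₀` through `(a, φ_ε(a))` reaches zero at `1`. The
factor equals `2^(n(1-a)(1/r-s₀))`, so it is absorbed once `s ↦ log ‖f‖_{1/s}` drops at rate at
least `(1-a) n log 2` between `s₀` and `1/r` (`lqNorm_noise_le_of_growth`). That function is convex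
by Hölder. With `Ent` known, its slope at `s = 1` is known and the slopes to the left are steeper.
With `Ent₂` known, its total drop from `1/2` to `1` is known; it cannot drop faster than `n log 2`,
so a failure of the required rate would make the total too small exactly when `α` solves the stated
equation. The exponent `q₀` is the limiting case at `t = 1`. -/

/-- The quadratic form `(1 - δ)(u² + v²) + 2δuv` at `(1, t)`. -/
def pairWeight (δ t : ℝ) : ℝ := (1 - δ) * (1 + t ^ 2) + 2 * δ * t

/-- The marginal of the pair distribution proportional to `((1-δ)t², δt, δt, 1-δ)`. -/
def pairBias (δ t : ℝ) : ℝ := ((1 - δ) * t ^ 2 + δ * t) / pairWeight δ t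

/-- The logarithmic ratio `log ((1 - δ + δt) / (δ + (1 - δ)t))` at `t = e^{-s}`. -/
def logRatio (δ s : ℝ) : ℝ :=
  Real.log (1 - δ + δ * Real.exp (-s)) - Real.log (δ + (1 - δ) * Real.exp (-s))

/-- The logarithm of the ratio between `pairWeight δ t` and the squared `ℓ_r` norm of `(1, t)`. -/
def logQuotient (δ r t : ℝ) : ℝ := Real.log (pairWeight δ t) - 2 / r * Real.log (1 + t ^ r)

/-! ### The critical point of the two-point quotient. -/

section

variable {δ : ℝ}

lemma pairWeight_pos (h0 : 0 ≤ δ) (h1 : δ ≤ 1 / 2) {t : ℝ} (ht : 0 ≤ t) : 0 < pairWeight δ t := by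
  unfold pairWeight
  have : 0 < (1 - δ) * (1 + t ^ 2) := mul_pos (by linarith) (by positivity)
  positivity

lemma lowerRatio_pos (h0 : 0 ≤ δ) (h1 : δ ≤ 1 / 2) {t : ℝ} (ht : 0 < t) :
    0 < δ + (1 - δ) * t := by
  have : 0 < (1 - δ) * t := mul_pos (by linarith) ht
  linarith

lemma upperRatio_pos (h0 : 0 ≤ δ) (h1 : δ ≤ 1 / 2) {t : ℝ} (ht : 0 ≤ t) :
    0 < 1 - δ + δ * t := by
  have : 0 ≤ δ * t := mul_nonneg h0 ht
  linarith

lemma logRatio_zero : logRatio δ 0 = 0 := by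
  simp [logRatio]

/-- The `cosh` form of the denominator shows that the derivative decreases on `s ≥ 0`, which is the
source of concavity and of every monotonicity in `t`. -/
lemma hasDerivAt_logRatio (h0 : 0 ≤ δ) (h1 : δ ≤ 1 / 2) (s : ℝ) :
    HasDerivAt (logRatio δ)
      ((1 - 2 * δ) / (δ * (1 - δ) * (2 * Real.cosh s) + ((1 - δ) ^ 2 + δ ^ 2))) s := by
  have ht := Real.exp_pos (-s)
  have hu := upperRatio_pos h0 h1 ht.le
  have hl := lowerRatio_pos h0 h1 ht
  have he : HasDerivAt (fun s : ℝ => Real.exp (-s)) (-Real.exp (-s)) s := by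
    simpa using (hasDerivAt_neg s).exp
  have ha := ((he.const_mul δ).const_add (1 - δ)).log hu.ne'
  have hb := ((he.const_mul (1 - δ)).const_add δ).log hl.ne'
  refine (ha.sub hb).congr_deriv ?_
  have hc : 2 * Real.cosh s = 1 / Real.exp (-s) + Real.exp (-s) := by
    rw [Real.cosh_eq, Real.exp_neg]; field_simp
  rw [hc]
  generalize Real.exp (-s) = t at ht hu hl
  have hd : δ * (1 - δ) * (1 / t + t) + ((1 - δ) ^ 2 + δ ^ 2)
      = (1 - δ + δ * t) * (δ + (1 - δ) * t) / t := by
    field_simp; ring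
  rw [hd, div_sub_div _ _ hu.ne' hl.ne', div_div_eq_mul_div]
  congr 1
  ring

lemma logRatio_deriv_pos (h0 : 0 ≤ δ) (h1 : δ ≤ 1 / 2) (s : ℝ) :
    0 < δ * (1 - δ) * (2 * Real.cosh s) + ((1 - δ) ^ 2 + δ ^ 2) := by
  have h2 : 0 ≤ δ * (1 - δ) := mul_nonneg h0 (by linarith)
  have h3 := Real.cosh_pos s
  have h4 : 0 < (1 - δ) ^ 2 := pow_pos (by linarith) 2
  positivity

lemma concaveOn_logRatio (h0 : 0 ≤ δ) (h1 : δ ≤ 1 / 2) :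
    ConcaveOn ℝ (Set.Ici 0) (logRatio δ) := by
  refine AntitoneOn.concaveOn_of_deriv (convex_Ici 0)
    (fun s _ => (hasDerivAt_logRatio h0 h1 s).continuousAt.continuousWithinAt)
    (fun s _ => (hasDerivAt_logRatio h0 h1 s).differentiableAt.differentiableWithinAt) ?_
  intro a ha b hb hab
  rw [interior_Ici, Set.mem_Ioi] at ha hb
  rw [(hasDerivAt_logRatio h0 h1 a).deriv, (hasDerivAt_logRatio h0 h1 b).deriv]
  have hc : Real.cosh a ≤ Real.cosh b := by
    rw [Real.cosh_le_cosh, abs_of_pos ha, abs_of_pos hb]; exact hab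
  have h2 : 0 ≤ δ * (1 - δ) := mul_nonneg h0 (by linarith)
  exact div_le_div_of_nonneg_left (by linarith) (logRatio_deriv_pos h0 h1 a) (by gcongr)

/-- Chords from the origin of a concave function vanishing at `0` have decreasing slope. -/
lemma logRatio_div_anti (h0 : 0 ≤ δ) (h1 : δ ≤ 1 / 2) {a b : ℝ} (ha : 0 < a) (hab : a ≤ b) :
    logRatio δ b / b ≤ logRatio δ a / a := by
  rcases hab.eq_or_lt with rfl | hab
  · exact le_rfl
  have hb : 0 < b := ha.trans hab
  have := (concaveOn_logRatio h0 h1).2 (Set.mem_Ici.2 le_rfl) (Set.mem_Ici.2 hb.le)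
    (show 0 ≤ 1 - a / b by rw [sub_nonneg, div_le_one hb]; exact hab.le)
    (show 0 ≤ a / b by positivity) (by ring)
  simp only [logRatio_zero, smul_eq_mul, mul_zero, zero_add] at this
  rw [div_mul_cancel₀ _ hb.ne'] at this
  rw [le_div_iff₀ ha]
  calc _ = a / b * logRatio δ b := by ring
    _ ≤ _ := this

lemma tendsto_logRatio_div (h0 : 0 ≤ δ) (h1 : δ ≤ 1 / 2) :
    Filter.Tendsto (fun s => logRatio δ s / s) (nhdsWithin 0 (Set.Ioi 0))
      (nhds (1 - 2 * δ)) := by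
  have h := hasDerivAt_logRatio h0 h1 0
  have h2 : (1 - 2 * δ) / (δ * (1 - δ) * (2 * Real.cosh 0) + ((1 - δ) ^ 2 + δ ^ 2))
      = 1 - 2 * δ := by
    rw [Real.cosh_zero]
    have : δ * (1 - δ) * (2 * 1) + ((1 - δ) ^ 2 + δ ^ 2) = 1 := by ring
    rw [this, div_one]
  rw [h2] at h
  have h3 := h.tendsto_slope_zero_right
  simp only [zero_add, logRatio_zero, sub_zero, smul_eq_mul] at h3
  refine h3.congr fun s => ?_
  rw [div_eq_inv_mul]

lemma logRatio_div_le (h0 : 0 ≤ δ) (h1 : δ ≤ 1 / 2) {s : ℝ} (hs : 0 < s) :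
    logRatio δ s / s ≤ 1 - 2 * δ := by
  refine ge_of_tendsto (tendsto_logRatio_div h0 h1) ?_
  filter_upwards [Ioc_mem_nhdsGT hs] with a ha
  exact logRatio_div_anti h0 h1 ha.1 ha.2

lemma logRatio_nonneg (h0 : 0 ≤ δ) (h1 : δ ≤ 1 / 2) {s : ℝ} (hs : 0 ≤ s) : 0 ≤ logRatio δ s := by
  have h2 : Real.exp (-s) ≤ 1 := by simpa using hs
  refine sub_nonneg.2 (Real.log_le_log (lowerRatio_pos h0 h1 (Real.exp_pos _)) ?_)
  nlinarith

lemma logRatio_pos (h0 : 0 ≤ δ) (h1 : δ < 1 / 2) {s : ℝ} (hs : 0 < s) : 0 < logRatio δ s := by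
  have h2 : Real.exp (-s) < 1 := by simpa using hs
  refine sub_pos.2 (Real.log_lt_log (lowerRatio_pos h0 h1.le (Real.exp_pos _)) ?_)
  nlinarith

/-- The exponent `r` for which `t` is the critical point of `logQuotient δ r`. -/
def critExp (δ t : ℝ) : ℝ := 1 + logRatio δ (-Real.log t) / (-Real.log t)

lemma neg_log_pos {t : ℝ} (ht : t ∈ Set.Ioo (0 : ℝ) 1) : 0 < -Real.log t :=
  neg_pos.2 (Real.log_neg ht.1 ht.2)

lemma critExp_mono (h0 : 0 ≤ δ) (h1 : δ ≤ 1 / 2) {a b : ℝ} (ha : 0 < a) (hab : a ≤ b)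
    (hb : b < 1) : critExp δ a ≤ critExp δ b := by
  refine add_le_add le_rfl (logRatio_div_anti h0 h1 (neg_log_pos ⟨ha.trans_le hab, hb⟩) ?_)
  exact neg_le_neg (Real.log_le_log ha hab)

lemma critExp_le (h0 : 0 ≤ δ) (h1 : δ ≤ 1 / 2) {t : ℝ} (ht : t ∈ Set.Ioo (0 : ℝ) 1) :
    critExp δ t ≤ 2 - 2 * δ := by
  have := logRatio_div_le h0 h1 (neg_log_pos ht)
  unfold critExp; linarith

lemma one_le_critExp (h0 : 0 ≤ δ) (h1 : δ ≤ 1 / 2) {t : ℝ} (ht : t ∈ Set.Ioo (0 : ℝ) 1) :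
    1 ≤ critExp δ t := by
  have := div_nonneg (logRatio_nonneg h0 h1 (neg_log_pos ht).le) (neg_log_pos ht).le
  unfold critExp; linarith

lemma one_lt_critExp (h0 : 0 ≤ δ) (h1 : δ < 1 / 2) {t : ℝ} (ht : t ∈ Set.Ioo (0 : ℝ) 1) :
    1 < critExp δ t := by
  have := div_pos (logRatio_pos h0 h1 (neg_log_pos ht)) (neg_log_pos ht)
  unfold critExp; linarith

lemma tendsto_critExp (h0 : 0 ≤ δ) (h1 : δ ≤ 1 / 2) :
    Filter.Tendsto (critExp δ) (nhdsWithin 1 (Set.Ioo 0 1)) (nhds (2 - 2 * δ)) := by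
  have h2 : Filter.Tendsto (fun t => -Real.log t) (nhdsWithin 1 (Set.Ioo 0 1))
      (nhdsWithin 0 (Set.Ioi 0)) := by
    refine tendsto_nhdsWithin_iff.2 ⟨?_, ?_⟩
    · have : ContinuousAt (fun t => -Real.log t) 1 := (Real.continuousAt_log one_ne_zero).neg
      have h3 := this.tendsto
      simp only [Real.log_one, neg_zero] at h3
      exact h3.mono_left nhdsWithin_le_nhds
    · filter_upwards [self_mem_nhdsWithin] with t ht using neg_log_pos ht
  have h3 := ((tendsto_logRatio_div h0 h1).comp h2).const_add 1
  rw [show 1 + (1 - 2 * δ) = 2 - 2 * δ by ring] at h3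
  exact h3

/-- This is the critical-point equation: with `r = critExp δ t` the bracket in the derivative of
`logQuotient δ r` vanishes. -/
lemma rpow_critExp (h0 : 0 ≤ δ) (h1 : δ ≤ 1 / 2) {t : ℝ} (ht : t ∈ Set.Ioo (0 : ℝ) 1) :
    t ^ (critExp δ t - 1) = (δ + (1 - δ) * t) / (1 - δ + δ * t) := by
  have hl := lowerRatio_pos h0 h1 ht.1
  have hu := upperRatio_pos h0 h1 ht.1.le
  have hs := neg_log_pos ht
  rw [Real.rpow_def_of_pos ht.1]
  have : Real.log t * (critExp δ t - 1) = -logRatio δ (-Real.log t) := by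
    have h3 : Real.log t ≠ 0 := by linarith
    unfold critExp; field_simp; ring
  rw [this, logRatio, neg_neg, Real.exp_log ht.1, neg_sub, ← Real.log_div hl.ne' hu.ne',
    Real.exp_log (by positivity)]

/-- Factored so that the sign is that of the last bracket; by `rpow_critExp` this compares two
powers of `t`, hence `r` with `critExp δ t`. -/
lemma hasDerivAt_logQuotient (h0 : 0 ≤ δ) (h1 : δ ≤ 1 / 2) {r t : ℝ} (hr : 1 ≤ r) (ht : 0 < t) :
    HasDerivAt (logQuotient δ r)
      (2 * (1 - δ + δ * t) / (pairWeight δ t * (1 + t ^ r)) *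
        ((δ + (1 - δ) * t) / (1 - δ + δ * t) - t ^ (r - 1))) t := by
  have hZ := pairWeight_pos h0 h1 ht.le
  have hu := upperRatio_pos h0 h1 ht.le
  have hp : 0 < 1 + t ^ r := by positivity
  have hd : HasDerivAt (pairWeight δ) ((1 - δ) * (2 * t) + 2 * δ) t := by
    unfold pairWeight
    have := (((hasDerivAt_pow 2 t).const_add 1).const_mul (1 - δ)).add
      ((hasDerivAt_id t).const_mul (2 * δ))
    refine this.congr_deriv ?_
    simp
  have hq : HasDerivAt (fun t : ℝ => 1 + t ^ r) (r * t ^ (r - 1)) t :=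
    (Real.hasDerivAt_rpow_const (Or.inl ht.ne')).const_add 1
  refine ((hd.log hZ.ne').sub ((hq.log hp.ne').const_mul (2 / r))).congr_deriv ?_
  have hr0 : r ≠ 0 := by linarith
  have he : t ^ r = t ^ (r - 1) * t := by
    rw [← Real.rpow_add_one ht.ne']; ring_nf
  rw [he] at hp ⊢
  field_simp
  unfold pairWeight
  ring

/-- `logQuotient δ r` increases up to a critical point and decreases after it. -/
lemma logQuotient_le (h0 : 0 ≤ δ) (h1 : δ ≤ 1 / 2) {r a : ℝ} (hr : 1 ≤ r)
    (ha : a ∈ Set.Ioc (0 : ℝ) 1) (hlo : ∀ t ∈ Set.Ioo 0 a, critExp δ t ≤ r)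
    (hhi : ∀ t ∈ Set.Ioo a 1, r ≤ critExp δ t) {t : ℝ} (ht : t ∈ Set.Ioc (0 : ℝ) 1) :
    logQuotient δ r t ≤ logQuotient δ r a := by
  have hfac : ∀ t : ℝ, 0 < t → 0 ≤ 2 * (1 - δ + δ * t) / (pairWeight δ t * (1 + t ^ r)) := by
    intro t ht
    have := pairWeight_pos h0 h1 ht.le
    have := upperRatio_pos h0 h1 ht.le
    positivity
  rcases le_total t a with hta | hta
  · refine monotoneOn_of_deriv_nonneg (convex_Ioc 0 a)
      (fun u hu => (hasDerivAt_logQuotient h0 h1 hr hu.1).continuousAt.continuousWithinAt)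
      ?_ ?_ ⟨ht.1, hta⟩ ⟨ha.1, le_rfl⟩ hta
    · rw [interior_Ioc]
      exact fun u hu =>
        (hasDerivAt_logQuotient h0 h1 hr hu.1).differentiableAt.differentiableWithinAt
    · rw [interior_Ioc]
      intro u hu
      have hu1 : u < 1 := hu.2.trans_le ha.2
      rw [(hasDerivAt_logQuotient h0 h1 hr hu.1).deriv, ← rpow_critExp h0 h1 ⟨hu.1, hu1⟩]
      refine mul_nonneg (hfac u hu.1) (sub_nonneg.2 ?_)
      exact Real.rpow_le_rpow_of_exponent_ge hu.1 hu1.le (by linarith [hlo u hu])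
  · have hpos : ∀ u ∈ Set.Icc a 1, 0 < u := fun u hu => ha.1.trans_le hu.1
    refine antitoneOn_of_deriv_nonpos (convex_Icc a 1)
      (fun u hu => (hasDerivAt_logQuotient h0 h1 hr (hpos u hu)).continuousAt.continuousWithinAt)
      ?_ ?_ ⟨le_rfl, ha.2⟩ ⟨hta, ht.2⟩ hta
    · rw [interior_Icc]
      exact fun u hu => (hasDerivAt_logQuotient h0 h1 hr
        (hpos u ⟨hu.1.le, hu.2.le⟩)).differentiableAt.differentiableWithinAt
    · rw [interior_Icc]
      intro u hu
      have hu0 := hpos u ⟨hu.1.le, hu.2.le⟩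
      rw [(hasDerivAt_logQuotient h0 h1 hr hu0).deriv, ← rpow_critExp h0 h1 ⟨hu0, hu.2⟩]
      refine mul_nonpos_of_nonneg_of_nonpos (hfac u hu0) (sub_nonpos.2 ?_)
      exact Real.rpow_le_rpow_of_exponent_ge hu0 hu.2.le (by linarith [hhi u hu])

lemma logQuotient_le_critExp (h0 : 0 ≤ δ) (h1 : δ ≤ 1 / 2) {a t : ℝ}
    (ha : a ∈ Set.Ioo (0 : ℝ) 1) (ht : t ∈ Set.Ioc (0 : ℝ) 1) :
    logQuotient δ (critExp δ a) t ≤ logQuotient δ (critExp δ a) a :=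
  logQuotient_le h0 h1 (one_le_critExp h0 h1 ha) ⟨ha.1, ha.2.le⟩
    (fun _ hu => critExp_mono h0 h1 hu.1 hu.2.le ha.2)
    (fun _ hu => critExp_mono h0 h1 ha.1 hu.1.le hu.2) ht

lemma logQuotient_one (r : ℝ) : logQuotient δ r 1 = (1 - 2 / r) * Real.log 2 := by
  have : (1 - δ) * (1 + 1 ^ 2) + 2 * δ * 1 = 2 := by ring
  rw [logQuotient, pairWeight, this, Real.one_rpow, one_add_one_eq_two]
  ring

lemma logQuotient_le_one (h0 : 0 ≤ δ) (h1 : δ ≤ 1 / 2) {t : ℝ} (ht : t ∈ Set.Ioc (0 : ℝ) 1) :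
    logQuotient δ (2 - 2 * δ) t ≤ (1 - 2 / (2 - 2 * δ)) * Real.log 2 := by
  rw [← logQuotient_one (δ := δ)]
  exact logQuotient_le h0 h1 (by linarith) ⟨one_pos, le_rfl⟩ (fun _ hu => critExp_le h0 h1 hu)
    (fun _ hu => absurd (hu.1.trans hu.2) (lt_irrefl _)) ht

end

/-! ### Parametrization of `Φ` by the two-point problem. -/

lemma H_eq (t : ℝ) : H t = Real.binEntropy t / Real.log 2 := by
  simp only [H, Real.binEntropy, Real.logb, one_div]
  ring

lemma HInv_H {s : ℝ} (hs : s ∈ Set.Icc (0 : ℝ) (1 / 2)) : HInv (H s) = s := by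
  refine Set.InjOn.leftInvOn_invFunOn ?_ hs
  intro a ha b hb hab
  rw [H_eq, H_eq, div_left_inj' (Real.log_pos one_lt_two).ne'] at hab
  rw [one_div] at ha hb
  exact Real.binEntropy_strictMonoOn.injOn ha hb hab

section

variable {δ : ℝ}

lemma one_sub_pairBias (h0 : 0 ≤ δ) (h1 : δ ≤ 1 / 2) {t : ℝ} (ht : 0 ≤ t) :
    1 - pairBias δ t = (δ * t + (1 - δ)) / pairWeight δ t := by
  have hZ := (pairWeight_pos h0 h1 ht).ne'
  unfold pairBias
  rw [eq_div_iff hZ, sub_mul, div_mul_cancel₀ _ hZ, pairWeight]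
  ring

lemma pairBias_mem (h0 : 0 ≤ δ) (h1 : δ ≤ 1 / 2) {t : ℝ} (ht : t ∈ Set.Ioo (0 : ℝ) 1) :
    pairBias δ t ∈ Set.Ioo (0 : ℝ) (1 / 2) := by
  have hZ := pairWeight_pos h0 h1 ht.1.le
  have hl := mul_pos ht.1 (lowerRatio_pos h0 h1 ht.1)
  have ht2 : t ^ 2 < 1 := by nlinarith [ht.1, ht.2]
  refine ⟨div_pos (by linarith) hZ, ?_⟩
  unfold pairBias
  rw [div_lt_iff₀ hZ, pairWeight]
  nlinarith

lemma continuousOn_pairBias (h0 : 0 ≤ δ) (h1 : δ ≤ 1 / 2) :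
    ContinuousOn (pairBias δ) (Set.Icc 0 1) := by
  unfold pairBias
  refine ContinuousOn.div (by fun_prop) (by unfold pairWeight; fun_prop) ?_
  exact fun t ht => (pairWeight_pos h0 h1 ht.1).ne'

/-- The entropy of the marginal, in bits. -/
def pairEnt (δ t : ℝ) : ℝ := H (pairBias δ t)

lemma pairEnt_mul_log (t : ℝ) :
    pairEnt δ t * Real.log 2 = Real.binEntropy (pairBias δ t) := by
  rw [pairEnt, H_eq, div_mul_cancel₀ _ (Real.log_pos one_lt_two).ne']

lemma pairEnt_mem (h0 : 0 ≤ δ) (h1 : δ ≤ 1 / 2) {t : ℝ} (ht : t ∈ Set.Ioo (0 : ℝ) 1) :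
    pairEnt δ t ∈ Set.Ioo (0 : ℝ) 1 := by
  have hl := Real.log_pos one_lt_two
  have hm := pairBias_mem h0 h1 ht
  rw [pairEnt, H_eq]
  refine ⟨div_pos (Real.binEntropy_pos hm.1 (by linarith [hm.2])) hl, ?_⟩
  rw [div_lt_one hl]
  refine Real.binEntropy_lt_log_two.2 ?_
  have := hm.2
  rw [one_div] at this
  exact this.ne

lemma continuousOn_pairEnt (h0 : 0 ≤ δ) (h1 : δ ≤ 1 / 2) :
    ContinuousOn (pairEnt δ) (Set.Icc 0 1) := by
  have : pairEnt δ = fun t => Real.binEntropy (pairBias δ t) / Real.log 2 := by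
    ext t; rw [pairEnt, H_eq]
  rw [this]
  exact (Real.binEntropy_continuous.comp_continuousOn (continuousOn_pairBias h0 h1)).div_const _

lemma pairEnt_zero : pairEnt δ 0 = 0 := by
  simp [pairEnt, H_eq, pairBias]

lemma pairEnt_one : pairEnt δ 1 = 1 := by
  have : pairBias δ 1 = 2⁻¹ := by
    unfold pairBias pairWeight; norm_num; ring_nf
  rw [pairEnt, H_eq, this, Real.binEntropy_two_inv, div_self (Real.log_pos one_lt_two).ne']

lemma exists_pairEnt_eq (h0 : 0 ≤ δ) (h1 : δ ≤ 1 / 2) {a : ℝ} (ha : a ∈ Set.Ioo (0 : ℝ) 1) :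
    ∃ t ∈ Set.Ioo (0 : ℝ) 1, pairEnt δ t = a := by
  have := intermediate_value_Ioo zero_le_one (continuousOn_pairEnt h0 h1)
  rw [pairEnt_zero, pairEnt_one] at this
  exact this ha

/-- At the critical exponent the marginal of the pair distribution coincides with the law
proportional to `(t^r, 1)`, which is why the maximum can be read off from an entropy. -/
lemma pairBias_odds (h0 : 0 ≤ δ) (h1 : δ ≤ 1 / 2) {t : ℝ} (ht : t ∈ Set.Ioo (0 : ℝ) 1) :
    pairBias δ t / (1 - pairBias δ t) = t ^ critExp δ t := by
  have hZ := (pairWeight_pos h0 h1 ht.1.le).ne'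
  have hu := (upperRatio_pos h0 h1 ht.1.le).ne'
  have : t ^ critExp δ t = t ^ (critExp δ t - 1) * t := by
    rw [← Real.rpow_add_one ht.1.ne']; ring_nf
  rw [this, rpow_critExp h0 h1 ht, one_sub_pairBias h0 h1 ht.1.le, pairBias, add_comm (δ * t),
    div_div_div_cancel_right₀ hZ]
  ring

/-- Entropy of a distribution with odds `t ^ r`. -/
lemma binEntropy_of_odds {s r t : ℝ} (hs : s ∈ Set.Ioo (0 : ℝ) 1) (ht : 0 < t)
    (hst : s / (1 - s) = t ^ r) :
    Real.binEntropy s = Real.log (1 + t ^ r) - r * s * Real.log t := by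
  have h1 : 0 < 1 - s := by linarith [hs.2]
  have h2 : 1 + t ^ r = (1 - s)⁻¹ := by rw [← hst]; field_simp; ring
  have h3 : Real.log s - Real.log (1 - s) = r * Real.log t := by
    rw [← Real.log_div hs.1.ne' h1.ne', hst, Real.log_rpow ht]
  rw [h2, Real.binEntropy, Real.log_inv, Real.log_inv]
  linear_combination (-s) * h3

/-- Twice `Φ` plus one, in nats, in terms of the parameter `t`. -/
def pairValue (δ t : ℝ) : ℝ := Real.log (pairWeight δ t) - 2 * pairBias δ t * Real.log t

lemma logQuotient_critExp (h0 : 0 ≤ δ) (h1 : δ ≤ 1 / 2) {t : ℝ} (ht : t ∈ Set.Ioo (0 : ℝ) 1) :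
    logQuotient δ (critExp δ t) t
      = pairValue δ t - 2 / critExp δ t * (pairEnt δ t * Real.log 2) := by
  have hm := pairBias_mem h0 h1 ht
  have hr : critExp δ t ≠ 0 := by linarith [one_le_critExp h0 h1 ht]
  rw [pairEnt_mul_log, binEntropy_of_odds ⟨hm.1, by linarith [hm.2]⟩ ht.1 (pairBias_odds h0 h1 ht),
    logQuotient, pairValue]
  field_simp
  ring

/-- `log (pairWeight δ t)` is convex in `log t` with derivative `2 * pairBias δ t`; this is its
tangent inequality, obtained from weighted AM-GM with the pair distribution as weights. -/
lemma pairBias_mul_log_le (h0 : 0 ≤ δ) (h1 : δ ≤ 1 / 2) {t u : ℝ} (ht : 0 < t) (hu : 0 < u) :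
    2 * pairBias δ t * (Real.log u - Real.log t)
      ≤ Real.log (pairWeight δ u) - Real.log (pairWeight δ t) := by
  have hZ := pairWeight_pos h0 h1 ht.le
  have hZu := pairWeight_pos h0 h1 hu.le
  have h2 : 0 < 1 - δ := by linarith
  have hq : 0 < u / t := by positivity
  have := Real.geom_mean_le_arith_mean3_weighted (w₁ := (1 - δ) * t ^ 2 / pairWeight δ t)
    (w₂ := 2 * δ * t / pairWeight δ t) (w₃ := (1 - δ) / pairWeight δ t)
    (p₁ := (u / t) ^ 2) (p₂ := u / t) (p₃ := 1) (by positivity) (by positivity) (by positivity)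
    (by positivity) hq.le zero_le_one (by
      rw [← add_div, ← add_div, div_eq_one_iff_eq hZ.ne', pairWeight]; ring)
  have he : (1 - δ) * t ^ 2 / pairWeight δ t * (u / t) ^ 2
      + 2 * δ * t / pairWeight δ t * (u / t) + (1 - δ) / pairWeight δ t * 1
      = pairWeight δ u / pairWeight δ t := by
    field_simp
    rw [pairWeight]; ring
  rw [he, Real.one_rpow, mul_one] at this
  have h3 := Real.log_le_log (by positivity) this
  rw [Real.log_mul (by positivity) (by positivity), Real.log_rpow (by positivity),
    Real.log_rpow hq, Real.log_pow, Real.log_div hu.ne' ht.ne',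
    Real.log_div hZu.ne' hZ.ne'] at h3
  refine le_trans (le_of_eq ?_) h3
  unfold pairBias
  push_cast
  ring

/-- A two-point bound controls `pairValue` by a linear function of the entropy. -/
lemma pairValue_le (h0 : 0 ≤ δ) (h1 : δ ≤ 1 / 2) {r M : ℝ} (hr : 0 < r)
    (hM : ∀ u ∈ Set.Ioc (0 : ℝ) 1, logQuotient δ r u ≤ M) {t : ℝ} (ht : t ∈ Set.Ioo (0 : ℝ) 1) :
    pairValue δ t ≤ M + 2 / r * (pairEnt δ t * Real.log 2) := by
  have hm := pairBias_mem h0 h1 ht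
  have h2 : 0 < 1 - pairBias δ t := by linarith [hm.2]
  have ho : 0 < pairBias δ t / (1 - pairBias δ t) := div_pos hm.1 h2
  -- The point whose law proportional to `(u^r, 1)` has the given marginal, so that the entropy
  -- formula is exact there.
  set u := (pairBias δ t / (1 - pairBias δ t)) ^ (1 / r) with hu
  have hu0 : 0 < u := Real.rpow_pos_of_pos ho _
  have hu1 : u ≤ 1 := by
    refine Real.rpow_le_one ho.le ?_ (by positivity)
    rw [div_le_one h2]; linarith [hm.2]
  have hur : pairBias δ t / (1 - pairBias δ t) = u ^ r := by
    rw [hu, ← Real.rpow_mul ho.le, one_div, inv_mul_cancel₀ hr.ne', Real.rpow_one]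
  have h3 := hM u ⟨hu0, hu1⟩
  have h4 := pairBias_mul_log_le h0 h1 ht.1 hu0
  rw [pairEnt_mul_log, binEntropy_of_odds ⟨hm.1, by linarith⟩ hu0 hur]
  have h5 : 2 / r * (Real.log (1 + u ^ r) - r * pairBias δ t * Real.log u)
      = 2 / r * Real.log (1 + u ^ r) - 2 * pairBias δ t * Real.log u := by
    field_simp
  rw [h5]
  unfold logQuotient at h3
  unfold pairValue
  linarith

/-- The quotient defining `yAux` is `δ w` for the nonnegative root `w` of `(1-2δ)w² + δw = σ(1-σ)`.
Recognizing the root avoids handling the square root later. -/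
lemma yAux_eq {x s : ℝ} (h0 : 0 ≤ δ) (h1 : δ ≤ 1 / 2) (hx : HInv x = s) {y w : ℝ}
    (hw : 0 ≤ w) (hy : y = δ * w) (hs : s * (1 - s) = y + (1 - 2 * δ) * w ^ 2) :
    yAux x δ = y := by
  unfold yAux
  rw [hx]
  split_ifs with h
  · rw [hs, h]; ring
  · have h2 : 0 < 1 - 2 * δ := by
      have := lt_of_le_of_ne h1 h
      linarith
    have h3 : δ ^ 2 + 4 * (1 - 2 * δ) * s * (1 - s) = (δ + 2 * (1 - 2 * δ) * w) ^ 2 := by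
      rw [mul_assoc, hs, hy]; ring
    rw [h3, Real.sqrt_sq (by positivity), hy, div_eq_iff (by positivity)]
    ring

/-- Written with `z log z` terms so that it also holds when `y` or `s - y` is zero. -/
lemma mul_H_div {s y : ℝ} (hs : 0 < s) :
    s * H (y / s) * Real.log 2
      = s * Real.log s - y * Real.log y - (s - y) * Real.log (s - y) := by
  have h1 : 1 - y / s = (s - y) / s := by field_simp
  have h2 : ∀ z : ℝ, z * Real.log (z / s) = z * Real.log z - z * Real.log s := by
    intro z
    rcases eq_or_ne z 0 with rfl | hz
    · simp
    · rw [Real.log_div hz hs.ne']; ring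
  rw [H_eq, mul_assoc, div_mul_cancel₀ _ (Real.log_pos one_lt_two).ne',
    Real.binEntropy, h1, Real.log_inv, Real.log_inv]
  have h3 : s * (y / s * -Real.log (y / s) + (s - y) / s * -Real.log ((s - y) / s))
      = -(y * Real.log (y / s)) - (s - y) * Real.log ((s - y) / s) := by
    field_simp
    ring
  rw [h3, h2, h2]
  ring

/-- Here `σ` is `pairBias δ t`, and `y` is the off-diagonal mass `δt/Z` with `Z = pairWeight δ t`.
The other masses are `σ - y = (1-δ)t²/Z` and `1 - σ - y = (1-δ)/Z`, so the entropies and logarithms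
in `Φ` collapse to `log Z` and `log t`. -/
lemma Phi_pairEnt (h0 : 0 ≤ δ) (h1 : δ ≤ 1 / 2) {t : ℝ} (ht : t ∈ Set.Ioo (0 : ℝ) 1) :
    (2 * Phi (pairEnt δ t) δ + 1) * Real.log 2 = pairValue δ t := by
  have hZ := pairWeight_pos h0 h1 ht.1.le
  have hm := pairBias_mem h0 h1 ht
  have hl := (Real.log_pos one_lt_two).ne'
  have hδ : 0 < 1 - δ := by linarith
  set Z := pairWeight δ t with hZd
  set s := pairBias δ t with hsd
  have hs : s = ((1 - δ) * t ^ 2 + δ * t) / Z := rfl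
  have hs' : 1 - s = (δ * t + (1 - δ)) / Z := one_sub_pairBias h0 h1 ht.1.le
  have hinv : HInv (pairEnt δ t) = s := HInv_H ⟨hm.1.le, hm.2.le⟩
  set y := δ * (t / Z) with hy
  have hyA : yAux (pairEnt δ t) δ = y := by
    refine yAux_eq h0 h1 hinv (w := t / Z) (div_nonneg ht.1.le hZ.le) rfl ?_
    rw [hs', hs, hy]
    field_simp
    rw [hZd, pairWeight]
    ring
  have hsy : s - y = (1 - δ) * t ^ 2 / Z := by rw [hs, hy]; ring
  have hsy' : 1 - s - y = (1 - δ) / Z := by rw [hs', hy]; ring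
  have hlog1 : Real.log (s - y) = Real.log (1 - δ) + 2 * Real.log t - Real.log Z := by
    have := ht.1
    rw [hsy, Real.log_div (by positivity) hZ.ne', Real.log_mul hδ.ne' (by positivity),
      Real.log_pow]
    push_cast; ring
  have hlog2 : Real.log (1 - s - y) = Real.log (1 - δ) - Real.log Z := by
    rw [hsy', Real.log_div hδ.ne' hZ.ne']
  have hlog3 : y * Real.log y = y * (Real.log δ + Real.log t - Real.log Z) := by
    rcases h0.eq_or_lt with h | h
    · rw [hy, ← h]; simp
    · rw [hy, Real.log_mul h.ne' (div_pos ht.1 hZ).ne', Real.log_div ht.1.ne' hZ.ne']; ring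
  have hE := pairEnt_mul_log (δ := δ) t
  rw [← hsd, Real.binEntropy, Real.log_inv, Real.log_inv] at hE
  have hA := mul_H_div (y := y) hm.1
  have hB := mul_H_div (s := 1 - s) (y := y) (by linarith [hm.2])
  rw [hlog1, hlog3] at hA
  rw [hlog2, hlog3] at hB
  have hC : ∀ z : ℝ, Real.logb 2 z * Real.log 2 = Real.log z := fun z => by
    rw [Real.logb, div_mul_cancel₀ _ hl]
  unfold Phi pairValue
  rw [hinv, hyA]
  linear_combination hE + hA + hB + 2 * y * hC δ + (1 - 2 * y) * hC (1 - δ)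

lemma Phi_zero (h0 : 0 ≤ δ) : Phi 0 δ = 1 / 2 * (-1 + Real.logb 2 (1 - δ)) := by
  have hi : HInv 0 = 0 := by
    have := HInv_H (s := 0) (by norm_num)
    simpa [H_eq] using this
  have hy : yAux 0 δ = 0 := by
    unfold yAux
    rw [hi]
    split_ifs
    · simp
    · simp [Real.sqrt_sq h0]; left; ring
  unfold Phi
  rw [hi, hy]
  simp [H_eq]

/-! ### Supporting lines of `Φ`. -/

/-- The two-point inequality whose constant is a supporting line of `Φ(·, δ)` at `a`. -/
lemma exists_supporting_exponent (h0 : 0 ≤ δ) (h1 : δ ≤ 1 / 2) {a : ℝ}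
    (ha : a ∈ Set.Ico (0 : ℝ) 1) :
    ∃ r, 1 ≤ r ∧ r ≤ 2 ∧ 0 ≤ Phi a δ + (1 - a) / r ∧ ∀ t ∈ Set.Ioc (0 : ℝ) 1,
      logQuotient δ r t ≤ (2 * Phi a δ + 1 - 2 / r * a) * Real.log 2 := by
  have hl := Real.log_pos one_lt_two
  suffices h : ∃ r, 1 ≤ r ∧ r ≤ 2 ∧ ∀ t ∈ Set.Ioc (0 : ℝ) 1,
      logQuotient δ r t ≤ (2 * Phi a δ + 1 - 2 / r * a) * Real.log 2 by
    obtain ⟨r, hr1, hr2, h⟩ := h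
    refine ⟨r, hr1, hr2, ?_, h⟩
    have h3 := h 1 ⟨one_pos, le_rfl⟩
    rw [logQuotient_one, mul_le_mul_iff_left₀ hl] at h3
    have : (1 - a) / r = (2 / r - 2 / r * a) / 2 := by ring
    rw [this]; linarith
  rcases ha.1.eq_or_lt with rfl | ha0
  -- At `a = 0` the exponent `r = 1` works because the form is at most `(1-δ)(1+t)²` when `δ ≤ 1/2`.
  · refine ⟨1, le_rfl, one_le_two, fun t ht => ?_⟩
    have hZ := pairWeight_pos h0 h1 ht.1.le
    have ht0 := ht.1
    rw [Phi_zero h0]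
    have e : (2 * (1 / 2 * (-1 + Real.logb 2 (1 - δ))) + 1 - 2 / 1 * 0) * Real.log 2
        = Real.log (1 - δ) := by
      rw [Real.logb]; field_simp; ring
    rw [e, logQuotient, Real.rpow_one, sub_le_iff_le_add, div_one]
    have : 2 * Real.log (1 + t) = Real.log ((1 + t) ^ 2) := by rw [Real.log_pow]; norm_num
    rw [this, ← Real.log_mul (by linarith) (by positivity)]
    refine Real.log_le_log hZ ?_
    unfold pairWeight
    nlinarith
  · obtain ⟨b, hb, rfl⟩ := exists_pairEnt_eq h0 h1 ⟨ha0, ha.2⟩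
    refine ⟨critExp δ b, one_le_critExp h0 h1 hb, by linarith [critExp_le h0 h1 hb],
      fun t ht => (logQuotient_le_critExp h0 h1 hb ht).trans_eq ?_⟩
    rw [logQuotient_critExp h0 h1 hb, ← Phi_pairEnt h0 h1 hb]
    ring

/-- Concavity of `Φ(·, δ)` in tangent-line form, with slope `1 / critExp δ t`. -/
lemma Phi_le_critExp (h0 : 0 ≤ δ) (h1 : δ ≤ 1 / 2) {t u : ℝ} (ht : t ∈ Set.Ioo (0 : ℝ) 1)
    (hu : u ∈ Set.Ioo (0 : ℝ) 1) :
    Phi (pairEnt δ u) δ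
      ≤ Phi (pairEnt δ t) δ + (pairEnt δ u - pairEnt δ t) / critExp δ t := by
  have hl := Real.log_pos one_lt_two
  have h := pairValue_le h0 h1 (by linarith [one_le_critExp h0 h1 ht])
    (fun u hu => logQuotient_le_critExp h0 h1 ht hu) hu
  rw [logQuotient_critExp h0 h1 ht, ← Phi_pairEnt h0 h1 hu, ← Phi_pairEnt h0 h1 ht] at h
  refine le_of_mul_le_mul_right ?_ (mul_pos two_pos hl)
  rw [div_eq_mul_inv]
  rw [div_eq_mul_inv] at h
  linarith

/-- The tangent line is nonnegative at `1`: evaluate the two-point bound at the constant pair `t =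
1`. -/
lemma critExp_chord_nonneg (h0 : 0 ≤ δ) (h1 : δ ≤ 1 / 2) {t : ℝ} (ht : t ∈ Set.Ioo (0 : ℝ) 1) :
    0 ≤ Phi (pairEnt δ t) δ + (1 - pairEnt δ t) / critExp δ t := by
  have hl := Real.log_pos one_lt_two
  have h := logQuotient_le_critExp h0 h1 ht ⟨one_pos, le_rfl⟩
  rw [logQuotient_critExp h0 h1 ht, ← Phi_pairEnt h0 h1 ht, logQuotient_one] at h
  refine le_of_mul_le_mul_right ?_ (mul_pos two_pos hl)
  rw [div_eq_mul_inv]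
  rw [div_eq_mul_inv] at h
  linarith

/-- The supporting line at the endpoint `1`, coming from the limiting exponent `2 - 2δ`. -/
lemma Phi_le (h0 : 0 ≤ δ) (h1 : δ ≤ 1 / 2) {a : ℝ} (ha : a ∈ Set.Ico (0 : ℝ) 1) :
    Phi a δ ≤ (a - 1) / (2 - 2 * δ) := by
  have hl := Real.log_pos one_lt_two
  have hd : 0 < 2 - 2 * δ := by linarith
  rcases ha.1.eq_or_lt with rfl | ha0
  · rw [Phi_zero h0, Real.logb, le_div_iff₀ hd]
    -- Convexity of `z log z` at `1 - δ`, an average of `1/2` and `1` with weights `2δ` and `1 -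
    -- 2δ`.
    have h := Real.convexOn_mul_log.2 (Set.mem_Ici.2 (show (0 : ℝ) ≤ 1 / 2 by norm_num))
      (Set.mem_Ici.2 (zero_le_one (α := ℝ))) (show 0 ≤ 2 * δ by linarith)
      (show 0 ≤ 1 - 2 * δ by linarith) (by ring)
    simp only [smul_eq_mul, Real.log_one, mul_zero, add_zero] at h
    rw [show 2 * δ * (1 / 2) + (1 - 2 * δ) * 1 = 1 - δ by ring, one_div, Real.log_inv] at h
    have h2 : (1 - δ) * (Real.log (1 - δ) / Real.log 2) ≤ -δ := by
      rw [mul_div_assoc', div_le_iff₀ hl]; linarith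
    linarith
  · obtain ⟨b, hb, rfl⟩ := exists_pairEnt_eq h0 h1 ⟨ha0, ha.2⟩
    have h := pairValue_le h0 h1 hd (fun u hu => logQuotient_le_one h0 h1 hu) hb
    rw [← Phi_pairEnt h0 h1 hb] at h
    refine le_of_mul_le_mul_right ?_ (mul_pos two_pos hl)
    rw [div_eq_mul_inv]
    rw [div_eq_mul_inv] at h
    linarith

/-! ### The equation for `α`. -/

/-- The function of `α` defining the exponent in terms of the second Rényi entropy. -/
def threshold (δ a : ℝ) : ℝ := 1 - a - a * Phi a δ / (1 - a)

lemma threshold_lt_one (h0 : 0 ≤ δ) (h1 : δ < 1 / 2) {t : ℝ} (ht : t ∈ Set.Ioo (0 : ℝ) 1) :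
    threshold δ (pairEnt δ t) < 1 := by
  have hm := pairEnt_mem h0 h1.le ht
  have hc := critExp_chord_nonneg h0 h1.le ht
  have hr := one_lt_critExp h0 h1 ht
  have h2 : 0 < 1 - pairEnt δ t := by linarith [hm.2]
  have h3 : (1 - pairEnt δ t) / critExp δ t < 1 - pairEnt δ t := div_lt_self h2 hr
  have h4 : -Phi (pairEnt δ t) δ / (1 - pairEnt δ t) < 1 := by rw [div_lt_one h2]; linarith
  have h5 := mul_lt_mul_of_pos_left h4 hm.1
  have : pairEnt δ t * (-Phi (pairEnt δ t) δ / (1 - pairEnt δ t))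
    = -(pairEnt δ t * Phi (pairEnt δ t) δ / (1 - pairEnt δ t)) := by ring
  unfold threshold
  linarith

/-- The threshold is `1 - a(1 + Φ/(1-a))`. The ratio `Φ/(1-a)` is nondecreasing by the supporting
line at the larger point, and the bracket is positive by `threshold_lt_one`. -/
lemma threshold_strictAnti (h0 : 0 ≤ δ) (h1 : δ < 1 / 2) :
    StrictAntiOn (threshold δ) (Set.Ico 0 1) := by
  intro a ha b hb hab
  have hb0 : 0 < b := ha.1.trans_lt hab
  obtain ⟨u, hu, rfl⟩ := exists_pairEnt_eq h0 h1.le ⟨hb0, hb.2⟩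
  rcases ha.1.eq_or_lt with rfl | ha0
  · simpa [threshold] using threshold_lt_one h0 h1 hu
  obtain ⟨t, ht, rfl⟩ := exists_pairEnt_eq h0 h1.le ⟨ha0, ha.2⟩
  have hlt := threshold_lt_one h0 h1 ht
  have hs := Phi_le_critExp h0 h1.le hu ht
  have hc := critExp_chord_nonneg h0 h1.le hu
  unfold threshold at hlt ⊢
  generalize Phi (pairEnt δ t) δ = A at *
  generalize Phi (pairEnt δ u) δ = B at *
  generalize pairEnt δ t = a at *
  generalize pairEnt δ u = b at *
  rw [div_eq_mul_inv] at hs hc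
  generalize (critExp δ u)⁻¹ = c at *
  have ha1 : 0 < 1 - a := by linarith [ha.2]
  have hb1 : 0 < 1 - b := by linarith [hb.2]
  have hch : A * (1 - b) ≤ B * (1 - a) := by
    have e1 := mul_le_mul_of_nonneg_right hs hb1.le
    have e2 := mul_nonneg (sub_nonneg.2 hab.le) hc
    linarith
  have hdiv : A / (1 - a) ≤ B / (1 - b) := by rwa [div_le_div_iff₀ ha1 hb1]
  rw [mul_div_assoc] at hlt ⊢
  rw [mul_div_assoc]
  have h3 : 0 < 1 + A / (1 - a) := by
    by_contra hcon
    have := mul_nonneg ha0.le (neg_nonneg.2 (not_lt.1 hcon))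
    linarith
  have e1 := mul_le_mul_of_nonneg_left hdiv hb0.le
  have e2 := mul_pos (sub_pos.2 hab) h3
  linarith

lemma threshold_surj (h0 : 0 ≤ δ) (h1 : δ ≤ 1 / 2) {v : ℝ} (hv : 1 / (2 - 2 * δ) < v)
    (hv1 : v ≤ 1) : ∃ a ∈ Set.Ico (0 : ℝ) 1, threshold δ a = v := by
  rcases hv1.eq_or_lt with rfl | hv1
  · exact ⟨0, by simp, by simp [threshold]⟩
  have hl := (Real.log_pos one_lt_two)
  have hval : ∀ t ∈ Set.Ioo (0 : ℝ) 1,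
      threshold δ (pairEnt δ t) = 1 - pairEnt δ t - pairEnt δ t *
        ((pairValue δ t / Real.log 2 - 1) / 2) / (1 - pairEnt δ t) := by
    intro t ht
    rw [← Phi_pairEnt h0 h1 ht, threshold, mul_div_cancel_right₀ _ hl.ne']
    ring_nf
  have hcX : ContinuousOn (pairEnt δ) (Set.Ioo 0 1) :=
    (continuousOn_pairEnt h0 h1).mono Set.Ioo_subset_Icc_self
  have hcV : ContinuousOn (pairValue δ) (Set.Ioo 0 1) := by
    refine ContinuousOn.sub (ContinuousOn.log (by unfold pairWeight; fun_prop) ?_)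
      (ContinuousOn.mul (continuousOn_const.mul
        ((continuousOn_pairBias h0 h1).mono Set.Ioo_subset_Icc_self))
        (ContinuousOn.log continuousOn_id fun t ht => ht.1.ne'))
    exact fun t ht => (pairWeight_pos h0 h1 ht.1.le).ne'
  have hcont : ContinuousOn (fun t => threshold δ (pairEnt δ t)) (Set.Ioo 0 1) := by
    refine ContinuousOn.congr ?_ hval
    refine (continuousOn_const.sub hcX).sub ((hcX.mul
      (((hcV.div_const _).sub continuousOn_const).div_const _)).div
      (continuousOn_const.sub hcX) ?_)
    intro t ht
    linarith [(pairEnt_mem h0 h1 ht).2]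
  have hlow : ∃ t ∈ Set.Ioo (0 : ℝ) 1, v < threshold δ (pairEnt δ t) := by
    -- Since `Φ ≤ 0`, the threshold at `a` is at least `1 - a`, here `(1+v)/2 > v`.
    obtain ⟨t, ht, hX⟩ := exists_pairEnt_eq h0 h1 (a := (1 - v) / 2)
      ⟨by linarith, by linarith [one_div_pos.2 (show 0 < 2 - 2 * δ by linarith)]⟩
    refine ⟨t, ht, ?_⟩
    have hm := pairEnt_mem h0 h1 ht
    have hP := Phi_le h0 h1 ⟨hm.1.le, hm.2⟩
    have hneg : Phi (pairEnt δ t) δ ≤ 0 :=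
      hP.trans (div_nonpos_of_nonpos_of_nonneg (by linarith [hm.2]) (by linarith))
    have : pairEnt δ t * Phi (pairEnt δ t) δ / (1 - pairEnt δ t) ≤ 0 :=
      div_nonpos_of_nonpos_of_nonneg (mul_nonpos_of_nonneg_of_nonpos hm.1.le hneg)
        (by linarith [hm.2])
    unfold threshold
    linarith
  have hhigh : ∃ t ∈ Set.Ioo (0 : ℝ) 1, threshold δ (pairEnt δ t) < v := by
    -- As `t → 1` the upper bound `1 - a + a / critExp δ t` tends to `1/(2-2δ)`, which is below `v`.
    have hX : Filter.Tendsto (pairEnt δ) (nhdsWithin 1 (Set.Ioo 0 1)) (nhds 1) := by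
      have := (continuousOn_pairEnt h0 h1 1 (by simp)).tendsto
      rw [pairEnt_one] at this
      exact this.mono_left (nhdsWithin_mono _ Set.Ioo_subset_Icc_self)
    have hT := (hX.const_sub 1).add
      (hX.mul ((tendsto_critExp h0 h1).inv₀ (by linarith)))
    rw [sub_self, zero_add, one_mul, ← one_div] at hT
    have : (nhdsWithin (1 : ℝ) (Set.Ioo 0 1)).NeBot := right_nhdsWithin_Ioo_neBot one_pos
    obtain ⟨t, ht, htm⟩ := ((hT.eventually_lt_const hv).and self_mem_nhdsWithin).exists
    refine ⟨t, htm, lt_of_le_of_lt ?_ ht⟩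
    have hm := pairEnt_mem h0 h1 htm
    have hc := critExp_chord_nonneg h0 h1 htm
    have h2 : 0 < 1 - pairEnt δ t := by linarith [hm.2]
    have h3 : -Phi (pairEnt δ t) δ / (1 - pairEnt δ t) ≤ (critExp δ t)⁻¹ := by
      rw [div_le_iff₀ h2, inv_mul_eq_div]; linarith
    have h5 := mul_le_mul_of_nonneg_left h3 hm.1.le
    have : pairEnt δ t * (-Phi (pairEnt δ t) δ / (1 - pairEnt δ t))
      = -(pairEnt δ t * Phi (pairEnt δ t) δ / (1 - pairEnt δ t)) := by ring
    unfold threshold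
    linarith
  obtain ⟨t, ht, h3⟩ := hlow
  obtain ⟨u, hu, h4⟩ := hhigh
  obtain ⟨w, hw, h5⟩ := isPreconnected_Ioo.intermediate_value hu ht hcont ⟨h4.le, h3.le⟩
  have hm := pairEnt_mem h0 h1 hw
  exact ⟨_, ⟨hm.1.le, hm.2⟩, h5⟩

end

/-! ### Tensorization of the two-point inequality. -/

section

variable {n : ℕ} {ε : ℝ}

lemma noise_kernel_eq_prod (x y : Cube n) :
    ε ^ hammingDist y x * (1 - ε) ^ (n - hammingDist y x)
      = ∏ i, if y i ≠ x i then ε else 1 - ε := by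
  rw [Finset.prod_ite, Finset.prod_const, Finset.prod_const]
  have h := Finset.card_filter_add_card_filter_not (s := (Finset.univ : Finset (Fin n)))
    (fun i => y i ≠ x i)
  rw [Finset.card_univ, Fintype.card_fin] at h
  unfold hammingDist
  congr 2
  omega

lemma sum_cube_succ (F : Cube (n + 1) → ℝ) :
    ∑ z, F z = ∑ x : Cube n, F (Fin.cons true x) + ∑ x : Cube n, F (Fin.cons false x) := by
  rw [← (Fin.consEquiv fun _ : Fin (n + 1) => Bool).sum_comp, Fintype.sum_prod_type,
    Fintype.sum_bool]
  rfl

lemma noise_cons (f : Cube (n + 1) → ℝ) (b : Bool) (x : Cube n) :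
    noise ε f (Fin.cons b x) = (1 - ε) * noise ε (fun z => f (Fin.cons b z)) x
      + ε * noise ε (fun z => f (Fin.cons (!b) z)) x := by
  simp only [noise, noise_kernel_eq_prod]
  rw [sum_cube_succ, Finset.mul_sum, Finset.mul_sum]
  simp only [Fin.prod_univ_succ, Fin.cons_zero, Fin.cons_succ]
  cases b
  · simp [mul_assoc, add_comm]
  · simp [mul_assoc]

lemma abs_noise_le (h0 : 0 ≤ ε) (h1 : ε ≤ 1 / 2) (f : Cube n → ℝ) (x : Cube n) :
    |noise ε f x| ≤ noise ε (fun y => |f y|) x := by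
  have h2 : 0 ≤ 1 - ε := by linarith
  refine (Finset.abs_sum_le_sum_abs _ _).trans (Finset.sum_le_sum fun y _ => ?_)
  rw [abs_mul, abs_of_nonneg (by positivity)]

/-- Tensorization of a two-point inequality for the noise operator. -/
lemma sum_noise_sq_le (h0 : 0 ≤ ε) (h1 : ε ≤ 1 / 2) {K r : ℝ} (hK : 0 ≤ K) (hr : 0 < r)
    (hQ : ∀ u v : ℝ, 0 ≤ u → 0 ≤ v →
      (1 - 2 * ε * (1 - ε)) * (u ^ 2 + v ^ 2) + 2 * (2 * ε * (1 - ε)) * (u * v)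
        ≤ K * (u ^ r + v ^ r) ^ (2 / r)) :
    ∀ {n : ℕ} (f : Cube n → ℝ), (∀ x, 0 ≤ f x) →
      ∑ x, noise ε f x ^ 2 ≤ K ^ n * (∑ x, f x ^ r) ^ (2 / r) := by
  intro n
  induction n with
  | zero =>
    intro f hf
    simp only [Fintype.sum_unique, noise, pow_zero, one_mul, zero_tsub,
      hammingDist_eq_zero.2 (Subsingleton.elim _ _)]
    rw [← Real.rpow_mul (hf _), mul_div_cancel₀ _ hr.ne', Real.rpow_two]
  | succ n ih =>
    intro f hf
    set f₁ := fun z : Cube n => f (Fin.cons true z) with hf₁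
    set f₀ := fun z : Cube n => f (Fin.cons false z) with hf₀
    have ih₁ := ih f₁ fun x => hf _
    have ih₀ := ih f₀ fun x => hf _
    set A := ∑ x, noise ε f₁ x ^ 2 with hA
    set B := ∑ x, noise ε f₀ x ^ 2 with hB
    have hA0 : 0 ≤ A := Finset.sum_nonneg fun _ _ => sq_nonneg _
    have hB0 : 0 ≤ B := Finset.sum_nonneg fun _ _ => sq_nonneg _
    have hCS : ∑ x, noise ε f₁ x * noise ε f₀ x ≤ √A * √B :=
      Real.sum_mul_le_sqrt_mul_sqrt _ _ _
    have hsum : ∑ x, noise ε f x ^ 2 = (1 - 2 * ε * (1 - ε)) * (A + B)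
        + 2 * (2 * ε * (1 - ε)) * ∑ x, noise ε f₁ x * noise ε f₀ x := by
      rw [sum_cube_succ, hA, hB, ← Finset.sum_add_distrib, ← Finset.sum_add_distrib,
        Finset.mul_sum, Finset.mul_sum, ← Finset.sum_add_distrib]
      refine Finset.sum_congr rfl fun x _ => ?_
      rw [noise_cons, noise_cons]
      simp only [Bool.not_true, Bool.not_false, ← hf₁, ← hf₀]
      ring
    -- The induction hypothesis raised to the power `r/2`, so that it fits the right side of the
    -- two-point inequality at `(√A, √B)`.
    have hroot : ∀ {S T : ℝ}, 0 ≤ S → 0 ≤ T → S ≤ K ^ n * T ^ (2 / r) →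
        √S ^ r ≤ (K ^ n) ^ (r / 2) * T := by
      intro S T hS hT h
      have h2 := Real.rpow_le_rpow hS h (show 0 ≤ r / 2 by positivity)
      rw [Real.mul_rpow (by positivity) (by positivity), ← Real.rpow_mul hT,
        div_mul_div_cancel₀ hr.ne', div_self two_ne_zero, Real.rpow_one] at h2
      refine le_trans (le_of_eq ?_) h2
      rw [Real.sqrt_eq_rpow, ← Real.rpow_mul hS]
      congr 1; ring
    have hT₁ : 0 ≤ ∑ x, f₁ x ^ r := Finset.sum_nonneg fun _ _ => Real.rpow_nonneg (hf _) _
    have hT₀ : 0 ≤ ∑ x, f₀ x ^ r := Finset.sum_nonneg fun _ _ => Real.rpow_nonneg (hf _) _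
    have hε : 0 ≤ 2 * (2 * ε * (1 - ε)) := by
      have : 0 ≤ 1 - ε := by linarith
      positivity
    have hq := hQ (√A) (√B) (Real.sqrt_nonneg _) (Real.sqrt_nonneg _)
    rw [Real.sq_sqrt hA0, Real.sq_sqrt hB0] at hq
    calc ∑ x, noise ε f x ^ 2
        ≤ K * (√A ^ r + √B ^ r) ^ (2 / r) := by
          rw [hsum]
          exact le_trans (by gcongr) hq
      _ ≤ K * ((K ^ n) ^ (r / 2) * ∑ x, f x ^ r) ^ (2 / r) := by
          rw [sum_cube_succ (fun x => f x ^ r), mul_add]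
          gcongr
          · exact hroot hA0 hT₁ ih₁
          · exact hroot hB0 hT₀ ih₀
      _ = K ^ (n + 1) * (∑ x, f x ^ r) ^ (2 / r) := by
          rw [Real.mul_rpow (by positivity)
            (Finset.sum_nonneg fun _ _ => Real.rpow_nonneg (hf _) _),
            ← Real.rpow_mul (by positivity), div_mul_div_cancel₀ two_ne_zero,
            div_self hr.ne', Real.rpow_one]
          ring

/-- A bound on `logQuotient` gives the corresponding homogeneous two-point inequality. -/
lemma two_point_of_logQuotient {δ : ℝ} (h0 : 0 ≤ δ) (h1 : δ ≤ 1 / 2) {r M : ℝ} (hr : 0 < r)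
    (hM : ∀ t ∈ Set.Ioc (0 : ℝ) 1, logQuotient δ r t ≤ M) {u v : ℝ} (hu : 0 ≤ u) (hv : 0 ≤ v) :
    (1 - δ) * (u ^ 2 + v ^ 2) + 2 * δ * (u * v) ≤ Real.exp M * (u ^ r + v ^ r) ^ (2 / r) := by
  have hpos : ∀ t ∈ Set.Ioc (0 : ℝ) 1, pairWeight δ t ≤ Real.exp M * (1 + t ^ r) ^ (2 / r) := by
    intro t ht
    have ht0 := ht.1
    have hZ := pairWeight_pos h0 h1 ht.1.le
    have hp : 0 < 1 + t ^ r := by positivity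
    have h2 : Real.log (pairWeight δ t) ≤ M + 2 / r * Real.log (1 + t ^ r) := by
      have := hM t ht
      unfold logQuotient at this
      linarith
    rw [← Real.log_le_log_iff hZ (by positivity), Real.log_mul (Real.exp_ne_zero _)
      (by positivity), Real.log_exp, Real.log_rpow hp]
    exact h2
  -- The endpoint `t = 0` follows by continuity.
  have hall : ∀ t ∈ Set.Icc (0 : ℝ) 1,
      pairWeight δ t ≤ Real.exp M * (1 + t ^ r) ^ (2 / r) := by
    intro t ht
    have hc : closure (Set.Ioc (0 : ℝ) 1) = Set.Icc 0 1 := closure_Ioc zero_ne_one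
    rw [← hc] at ht
    have hcont : Continuous fun t : ℝ => Real.exp M * (1 + t ^ r) ^ (2 / r) := by
      refine continuous_const.mul (Continuous.rpow_const ?_ fun _ => Or.inr (by positivity))
      exact continuous_const.add (Real.continuous_rpow_const hr.le)
    refine closure_minimal (fun t ht => hpos t ht) (isClosed_le ?_ hcont) ht
    unfold pairWeight; fun_prop
  wlog huv : u ≤ v generalizing u v
  · have := this hv hu (le_of_not_ge huv)
    rw [add_comm (u ^ 2), add_comm (u ^ r), mul_comm u]
    exact this
  rcases hv.eq_or_lt with rfl | hv
  · obtain rfl : u = 0 := le_antisymm huv hu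
    simp only [ne_eq, OfNat.ofNat_ne_zero, not_false_eq_true, zero_pow, add_zero, mul_zero]
    positivity
  · have h := hall (u / v) ⟨by positivity, by rwa [div_le_one hv]⟩
    have h2 := mul_le_mul_of_nonneg_right h (sq_nonneg v)
    refine (le_of_eq ?_).trans (h2.trans (le_of_eq ?_))
    · unfold pairWeight; field_simp; ring
    · have h3 : u ^ r + v ^ r = (1 + (u / v) ^ r) * v ^ r := by
        rw [Real.div_rpow hu hv.le]
        have := (Real.rpow_pos_of_pos hv r).ne'
        field_simp; ring
      rw [h3, Real.mul_rpow (by positivity) (by positivity), ← Real.rpow_mul hv.le,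
        mul_div_cancel₀ _ hr.ne', Real.rpow_two, mul_assoc]

lemma lqNorm_eq (q : ℝ) (f : Cube n → ℝ) :
    lqNorm q f = ((∑ x, |f x| ^ q) / 2 ^ n) ^ (1 / q) := rfl

lemma lqNorm_noise_le (h0 : 0 ≤ ε) (h1 : ε ≤ 1 / 2) {r M : ℝ} (hr : 0 < r)
    (hM : ∀ t ∈ Set.Ioc (0 : ℝ) 1, logQuotient (2 * ε * (1 - ε)) r t ≤ M) (f : Cube n → ℝ) :
    lqNorm 2 (noise ε f)
      ≤ Real.exp (n / 2 * (M - Real.log 2 + 2 / r * Real.log 2)) * lqNorm r f := by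
  have hδ0 : 0 ≤ 2 * ε * (1 - ε) := by
    have : 0 ≤ 1 - ε := by linarith
    positivity
  have hδ1 : 2 * ε * (1 - ε) ≤ 1 / 2 := by nlinarith [sq_nonneg (1 - 2 * ε)]
  have hS : 0 ≤ ∑ x, |f x| ^ r := Finset.sum_nonneg fun _ _ => by positivity
  have h := sum_noise_sq_le h0 h1 (Real.exp_pos M).le hr
    (fun u v hu hv => two_point_of_logQuotient hδ0 hδ1 hr hM hu hv) (fun x => |f x|)
    (fun x => abs_nonneg _)
  have h2 : ∑ x, |noise ε f x| ^ (2 : ℝ)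
      ≤ Real.exp M ^ n * (∑ x, |f x| ^ r) ^ (2 / r) := by
    refine le_trans (Finset.sum_le_sum fun x _ => ?_) h
    rw [Real.rpow_two]
    exact pow_le_pow_left₀ (abs_nonneg _) (abs_noise_le h0 h1 f x) 2
  have h3 : (∑ x, |noise ε f x| ^ (2 : ℝ)) / 2 ^ n
      ≤ (Real.exp (n / 2 * (M - Real.log 2 + 2 / r * Real.log 2)) * lqNorm r f) ^ (2 : ℝ) := by
    refine (div_le_div_of_nonneg_right h2 (by positivity)).trans (le_of_eq ?_)
    have hX : ∀ c : ℝ, ((2 : ℝ) ^ n) ^ c = Real.exp (n * Real.log 2 * c) := by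
      intro c
      rw [Real.rpow_def_of_pos (by positivity), Real.log_pow]
    rw [lqNorm_eq, Real.mul_rpow (Real.exp_pos _).le (by positivity),
      ← Real.rpow_mul (by positivity), Real.div_rpow hS (by positivity), ← Real.exp_mul, hX,
      one_div_mul_eq_div, mul_div_assoc', mul_comm (Real.exp _), div_eq_mul_inv,
      mul_div_assoc, mul_comm (Real.exp M ^ n), mul_assoc, ← Real.exp_sub, ← Real.exp_nat_mul]
    congr 1
    rw [← Real.rpow_one ((2 : ℝ) ^ n), hX, ← Real.exp_neg, ← Real.exp_add]
    congr 1
    ring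
  rw [lqNorm_eq]
  refine (Real.rpow_le_rpow (div_nonneg (Finset.sum_nonneg fun _ _ => by positivity)
    (by positivity)) h3 (by norm_num)).trans (le_of_eq ?_)
  rw [← Real.rpow_mul (by unfold lqNorm expectation; positivity)]
  norm_num

end

/-! ### Convexity and growth of the norms in `s = 1/p`. -/

section

variable {n : ℕ} {f : Cube n → ℝ}

lemma sum_abs_rpow_pos (hf : f ≠ 0) (p : ℝ) : 0 < ∑ x, |f x| ^ p := by
  obtain ⟨x, hx⟩ := Function.ne_iff.1 hf
  exact Finset.sum_pos' (fun _ _ => by positivity)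
    ⟨x, Finset.mem_univ _, Real.rpow_pos_of_pos (abs_pos.2 hx) _⟩

lemma lqNorm_pos (hf : f ≠ 0) (q : ℝ) : 0 < lqNorm q f := by
  rw [lqNorm_eq]
  exact Real.rpow_pos_of_pos (div_pos (sum_abs_rpow_pos hf q) (by positivity)) _

/-- The logarithm of the `ℓ_{1/s}` norm. -/
def logNorm (f : Cube n → ℝ) (s : ℝ) : ℝ := Real.log (lqNorm (1 / s) f)

lemma logNorm_eq (hf : f ≠ 0) (s : ℝ) :
    logNorm f s = s * (Real.log (∑ x, |f x| ^ (1 / s)) - n * Real.log 2) := by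
  have h := sum_abs_rpow_pos hf (1 / s)
  rw [logNorm, lqNorm_eq, Real.log_rpow (by positivity), one_div_one_div,
    Real.log_div h.ne' (by positivity), Real.log_pow]

/-- Lyapunov's inequality: Hölder applied to `|f|^(1/s) = |f|^(l/s) |f|^(m/s)`, with exponents
chosen to recover `|f|^(1/a)` and `|f|^(1/b)`. -/
lemma convexOn_logNorm (hf : f ≠ 0) : ConvexOn ℝ (Set.Ioi 0) (logNorm f) := by
  refine convexOn_iff_forall_pos.2 ⟨convex_Ioi 0, ?_⟩
  intro a ha b hb l m hl hm hlm
  rw [Set.mem_Ioi] at ha hb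
  simp only [smul_eq_mul]
  set s := l * a + m * b with hs
  have hs0 : 0 < s := by positivity
  have hA := sum_abs_rpow_pos hf (1 / a)
  have hB := sum_abs_rpow_pos hf (1 / b)
  have hS := sum_abs_rpow_pos hf (1 / s)
  have hconj : (s / (l * a)).HolderConjugate (s / (m * b)) := by
    refine Real.holderConjugate_iff.2 ⟨?_, ?_⟩
    · rw [one_lt_div (by positivity), hs]
      have : 0 < m * b := by positivity
      linarith
    · rw [inv_div, inv_div, ← add_div, ← hs, div_self hs0.ne']
  have h := Real.inner_le_Lp_mul_Lq_of_nonneg Finset.univ hconj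
    (f := fun x => |f x| ^ (l / s)) (g := fun x => |f x| ^ (m / s))
    (fun _ _ => by positivity) (fun _ _ => by positivity)
  have e1 : ∀ x, |f x| ^ (l / s) * |f x| ^ (m / s) = |f x| ^ (1 / s) := by
    intro x
    rw [← Real.rpow_add_of_nonneg (abs_nonneg _) (by positivity) (by positivity), ← add_div, hlm]
  have e2 : ∀ x, (|f x| ^ (l / s)) ^ (s / (l * a)) = |f x| ^ (1 / a) := by
    intro x
    rw [← Real.rpow_mul (abs_nonneg _)]
    congr 1; field_simp
  have e3 : ∀ x, (|f x| ^ (m / s)) ^ (s / (m * b)) = |f x| ^ (1 / b) := by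
    intro x
    rw [← Real.rpow_mul (abs_nonneg _)]
    congr 1; field_simp
  simp only [e1, e2, e3, one_div_div] at h
  have h2 := Real.log_le_log hS h
  rw [Real.log_mul (by positivity) (by positivity), Real.log_rpow hA, Real.log_rpow hB] at h2
  have h3 := mul_le_mul_of_nonneg_left h2 hs0.le
  rw [logNorm_eq hf, logNorm_eq hf, logNorm_eq hf]
  have e4 : s * (l * a / s * Real.log (∑ x, |f x| ^ (1 / a))
      + m * b / s * Real.log (∑ x, |f x| ^ (1 / b)))
      = l * a * Real.log (∑ x, |f x| ^ (1 / a)) + m * b * Real.log (∑ x, |f x| ^ (1 / b)) := by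
    field_simp
  rw [e4] at h3
  have e5 : s * (n * Real.log 2) = l * a * (n * Real.log 2) + m * b * (n * Real.log 2) := by
    rw [hs]; ring
  linarith

/-- The `ℓ_p` norms with respect to the counting measure decrease in `p`. -/
lemma logNorm_add_mono (hf : f ≠ 0) {s t : ℝ} (hs : 0 < s) (hst : s ≤ t) :
    logNorm f s + n * Real.log 2 * s ≤ logNorm f t + n * Real.log 2 * t := by
  have ht : 0 < t := hs.trans_le hst
  set T := ∑ x, |f x| ^ (1 / t) with hT
  have hT0 : 0 < T := sum_abs_rpow_pos hf (1 / t)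
  have hexp : 0 ≤ 1 / s - 1 / t := sub_nonneg.2 (one_div_le_one_div_of_le hs hst)
  have hbd : ∀ x, |f x| ≤ T ^ t := by
    intro x
    have h1 : |f x| ^ (1 / t) ≤ T :=
      Finset.single_le_sum (f := fun x => |f x| ^ (1 / t)) (fun _ _ => by positivity)
        (Finset.mem_univ x)
    have h2 := Real.rpow_le_rpow (by positivity) h1 ht.le
    rwa [← Real.rpow_mul (abs_nonneg _), one_div_mul_cancel ht.ne', Real.rpow_one] at h2
  have hsum : ∑ x, |f x| ^ (1 / s) ≤ T ^ (t / s) := by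
    have e : T ^ (t / s) = T * (T ^ t) ^ (1 / s - 1 / t) := by
      rw [← Real.rpow_mul hT0.le, ← Real.rpow_one_add' hT0.le (by positivity)]
      congr 1; field_simp; ring
    rw [e, hT, Finset.sum_mul, ← hT]
    refine Finset.sum_le_sum fun x _ => ?_
    have : |f x| ^ (1 / s) = |f x| ^ (1 / t) * |f x| ^ (1 / s - 1 / t) := by
      rw [← Real.rpow_add_of_nonneg (abs_nonneg _) (by positivity) hexp]
      congr 1; ring
    rw [this]
    gcongr
    exact hbd x
  have h := Real.log_le_log (sum_abs_rpow_pos hf (1 / s)) hsum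
  rw [Real.log_rpow hT0] at h
  have h2 := mul_le_mul_of_nonneg_left h hs.le
  have e : s * (t / s * Real.log T) = t * Real.log T := by field_simp
  rw [e] at h2
  rw [logNorm_eq hf, logNorm_eq hf, ← hT]
  linarith

lemma lqNorm_one (f : Cube n → ℝ) : lqNorm 1 f = (∑ x, |f x|) / 2 ^ n := by
  simp [lqNorm_eq]

lemma expectation_normalized (hf : f ≠ 0) : expectation (fun z => |f z| / lqNorm 1 f) = 1 := by
  have h := lqNorm_pos hf 1
  unfold expectation
  rw [← Finset.sum_div, div_right_comm, ← lqNorm_one, div_self h.ne']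

lemma ent_normalized (hf : f ≠ 0) :
    ent (fun z => |f z| / lqNorm 1 f)
      = expectation fun z => |f z| / lqNorm 1 f * Real.logb 2 (|f z| / lqNorm 1 f) := by
  rw [ent, expectation_normalized hf]
  simp

lemma ent_normalized_mul_log (hf : f ≠ 0) :
    ent (fun z => |f z| / lqNorm 1 f) * Real.log 2
      = (∑ x, |f x| * Real.log |f x|) / (∑ x, |f x|)
        - (Real.log (∑ x, |f x|) - n * Real.log 2) := by
  have hm := lqNorm_pos hf 1
  have hS : 0 < ∑ x, |f x| := by simpa using sum_abs_rpow_pos hf 1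
  have h1 : ∀ z, |f z| / lqNorm 1 f * Real.logb 2 (|f z| / lqNorm 1 f)
      = (|f z| * Real.log |f z| - |f z| * Real.log (lqNorm 1 f))
        / (lqNorm 1 f * Real.log 2) := by
    intro z
    rcases eq_or_ne (|f z|) 0 with h | h
    · simp [h]
    · rw [Real.logb, Real.log_div h hm.ne']
      field_simp
  have hlog : Real.log (lqNorm 1 f) = Real.log (∑ x, |f x|) - n * Real.log 2 := by
    rw [lqNorm_one, Real.log_div hS.ne' (by positivity), Real.log_pow]
  rw [ent_normalized hf]
  simp only [expectation, h1]
  rw [← Finset.sum_div, Finset.sum_sub_distrib, ← Finset.sum_mul, hlog, lqNorm_one]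
  have := (Real.log_pos one_lt_two).ne'
  field_simp

lemma ent_normalized_nonneg (hf : f ≠ 0) : 0 ≤ ent (fun z => |f z| / lqNorm 1 f) := by
  have hl := Real.log_pos one_lt_two
  rw [ent_normalized hf]
  have h1 : ∀ z, |f z| / lqNorm 1 f - 1
      ≤ |f z| / lqNorm 1 f * Real.logb 2 (|f z| / lqNorm 1 f) * Real.log 2 := by
    intro z
    have hg : 0 ≤ |f z| / lqNorm 1 f := div_nonneg (abs_nonneg _) (lqNorm_pos hf 1).le
    generalize |f z| / lqNorm 1 f = g at hg
    rw [Real.logb, mul_assoc, div_mul_cancel₀ _ hl.ne']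
    rcases hg.eq_or_lt with rfl | hg
    · simp
    · have := mul_le_mul_of_nonneg_left (Real.one_sub_inv_le_log_of_pos hg) hg.le
      rwa [mul_sub, mul_inv_cancel₀ hg.ne', mul_one] at this
  have h2 := Finset.sum_le_sum fun z (_ : z ∈ Finset.univ) => h1 z
  have h3 := expectation_normalized hf
  unfold expectation at h3 ⊢
  rw [div_eq_one_iff_eq (by positivity)] at h3
  rw [Finset.sum_sub_distrib, h3, ← Finset.sum_mul] at h2
  simp only [Finset.sum_const, Finset.card_univ, Fintype.card_pi, Fintype.card_bool,
    Finset.prod_const, Fintype.card_fin, nsmul_eq_mul, mul_one, Nat.cast_pow, Nat.cast_ofNat,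
    sub_self] at h2
  exact div_nonneg (nonneg_of_mul_nonneg_left h2 hl) (by positivity)

lemma ent_normalized_le (hf : f ≠ 0) : ent (fun z => |f z| / lqNorm 1 f) ≤ n := by
  have hm := lqNorm_pos hf 1
  have hS : 0 < ∑ x, |f x| := by simpa using sum_abs_rpow_pos hf 1
  rw [ent_normalized hf]
  have h1 : ∀ z, |f z| / lqNorm 1 f * Real.logb 2 (|f z| / lqNorm 1 f)
      ≤ |f z| / lqNorm 1 f * n := by
    intro z
    rcases (abs_nonneg (f z)).eq_or_lt with h | h
    · simp [← h]
    · have h3 : |f z| / lqNorm 1 f ≤ 2 ^ n := by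
        rw [lqNorm_one, div_div_eq_mul_div, div_le_iff₀ hS, mul_comm]
        gcongr
        exact Finset.single_le_sum (f := fun x => |f x|) (fun _ _ => abs_nonneg _)
          (Finset.mem_univ z)
      gcongr
      rw [Real.logb_le_iff_le_rpow one_lt_two (by positivity), Real.rpow_natCast]
      exact h3
  have h2 := Finset.sum_le_sum fun z (_ : z ∈ Finset.univ) => h1 z
  have h3 := expectation_normalized hf
  unfold expectation at h3 ⊢
  rw [div_eq_one_iff_eq (by positivity)] at h3
  rw [← Finset.sum_mul, h3] at h2
  rw [div_le_iff₀ (by positivity)]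
  linarith

lemma hasDerivAt_logNorm_one (hf : f ≠ 0) :
    HasDerivAt (logNorm f) (-(ent (fun z => |f z| / lqNorm 1 f) * Real.log 2)) 1 := by
  have hS : 0 < ∑ x, |f x| := by simpa using sum_abs_rpow_pos hf 1
  have hterm : ∀ c : ℝ, 0 ≤ c →
      HasDerivAt (fun s : ℝ => c ^ (1 / s)) (-(c * Real.log c)) 1 := by
    intro c hc
    rcases hc.eq_or_lt with rfl | hc
    · have : (fun s : ℝ => (0 : ℝ) ^ (1 / s)) =ᶠ[nhds 1] fun _ => 0 := by
        filter_upwards [eventually_ne_nhds one_ne_zero] with s hs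
        exact Real.zero_rpow (one_div_ne_zero hs)
      simpa using (hasDerivAt_const (1 : ℝ) (0 : ℝ)).congr_of_eventuallyEq this
    · have h := (hasDerivAt_inv (one_ne_zero (α := ℝ))).const_rpow hc
      simp only [one_div]
      refine h.congr_deriv ?_
      simp
      ring
  have hsum : HasDerivAt (fun s : ℝ => ∑ x, |f x| ^ (1 / s))
      (∑ x, -(|f x| * Real.log |f x|)) 1 :=
    HasDerivAt.fun_sum fun x _ => hterm _ (abs_nonneg _)
  have hsum1 : ∑ x, |f x| ^ (1 / (1 : ℝ)) = ∑ x, |f x| := by simp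
  have hlog := hsum.log (by rw [hsum1]; exact hS.ne')
  have h := (hasDerivAt_id (1 : ℝ)).mul (hlog.sub_const (n * Real.log 2))
  rw [funext (logNorm_eq hf)]
  refine h.congr_deriv ?_
  rw [hsum1, ent_normalized_mul_log hf, Finset.sum_neg_distrib]
  simp only [id]
  ring

/-- The entropy bounds the growth of the norms from `ℓ₁` on. -/
lemma logNorm_add_ent_le (hf : f ≠ 0) {s t : ℝ} (hs : 0 < s) (hst : s ≤ t) (ht : t ≤ 1) :
    logNorm f t + ent (fun z => |f z| / lqNorm 1 f) * Real.log 2 * (t - s) ≤ logNorm f s := by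
  rcases hst.eq_or_lt with rfl | hst
  · simp
  have hc := convexOn_logNorm hf
  have ht0 : 0 < t := hs.trans hst
  have hd := hasDerivAt_logNorm_one hf
  have key : (logNorm f t - logNorm f s) / (t - s)
      ≤ -(ent (fun z => |f z| / lqNorm 1 f) * Real.log 2) := by
    rcases ht.eq_or_lt with rfl | ht
    · have := hc.slope_le_of_hasDerivAt hs ht0 hst hd
      rwa [slope_def_field] at this
    · refine (hc.slope_mono_adjacent hs (Set.mem_Ioi.2 one_pos) hst ht).trans ?_
      have := hc.slope_le_of_hasDerivAt ht0 (Set.mem_Ioi.2 one_pos) ht hd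
      rwa [slope_def_field] at this
  rw [div_le_iff₀ (sub_pos.2 hst)] at key
  linarith

lemma renyiEnt_two_mul_log (hf : f ≠ 0) :
    renyiEnt 2 (fun z => f z / lqNorm 1 f) * Real.log 2
      = 2 * (logNorm f (1 / 2) - logNorm f 1) := by
  have hm := lqNorm_pos hf 1
  have hS := sum_abs_rpow_pos hf 2
  have h2 := lqNorm_pos hf 2
  have hscale : lqNorm 2 (fun z => f z / lqNorm 1 f) = lqNorm 2 f / lqNorm 1 f := by
    rw [lqNorm_eq]
    have : ∀ z, |f z / lqNorm 1 f| ^ (2 : ℝ) = |f z| ^ (2 : ℝ) / lqNorm 1 f ^ (2 : ℝ) := by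
      intro z
      rw [abs_div, abs_of_pos hm, Real.div_rpow (abs_nonneg _) hm.le]
    simp only [this]
    rw [← Finset.sum_div, div_right_comm, Real.div_rpow (by positivity) (by positivity),
      ← lqNorm_eq, ← Real.rpow_mul hm.le]
    norm_num
  rw [renyiEnt, hscale, Real.logb_rpow_eq_mul_logb_of_pos (by positivity), Real.logb,
    Real.log_div h2.ne' hm.ne', logNorm, logNorm, one_div_one_div, one_div_one]
  have := (Real.log_pos one_lt_two).ne'
  field_simp
  norm_num

end

/-! ### Norm bounds for the noise operator. -/

section

variable {ε : ℝ}

lemma corr_nonneg (h0 : 0 ≤ ε) (h1 : ε ≤ 1 / 2) : 0 ≤ 2 * ε * (1 - ε) :=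
  mul_nonneg (by linarith) (by linarith)

lemma corr_le_half (ε : ℝ) : 2 * ε * (1 - ε) ≤ 1 / 2 := by nlinarith [sq_nonneg (1 - 2 * ε)]

lemma qZero_eq (ε : ℝ) : qZero ε = 2 - 2 * (2 * ε * (1 - ε)) := by unfold qZero; ring

lemma one_le_qZero (ε : ℝ) : 1 ≤ qZero ε := by
  unfold qZero; linarith [sq_nonneg (1 - 2 * ε)]

lemma qZero_le_two (h0 : 0 ≤ ε) (h1 : ε ≤ 1 / 2) : qZero ε ≤ 2 := by
  rw [qZero_eq]; linarith [corr_nonneg h0 h1]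

/-- Hypercontractivity of the noise operator. -/
lemma lqNorm_noise_le_qZero (h0 : 0 ≤ ε) (h1 : ε ≤ 1 / 2) {n : ℕ} (f : Cube n → ℝ) :
    lqNorm 2 (noise ε f) ≤ lqNorm (qZero ε) f := by
  have h := lqNorm_noise_le (r := qZero ε) (M := (1 - 2 / qZero ε) * Real.log 2) h0 h1
    (by linarith [one_le_qZero ε]) (fun t ht => by
      rw [qZero_eq]
      exact logQuotient_le_one (corr_nonneg h0 h1) (corr_le_half ε) ht) f
  refine h.trans (le_of_eq ?_)
  rw [show (n / 2 * ((1 - 2 / qZero ε) * Real.log 2 - Real.log 2 + 2 / qZero ε * Real.log 2) : ℝ)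
    = 0 by ring, Real.exp_zero, one_mul]

/-- If the `ℓ_{1/s}` norms of `f` grow fast enough before `s = φ_ε(a)/(a - 1)`, then the noise
operator is bounded on `f` from the corresponding norm. -/
lemma lqNorm_noise_le_of_growth (h0 : 0 ≤ ε) (h1 : ε ≤ 1 / 2) {n : ℕ} {f : Cube n → ℝ}
    (hf : f ≠ 0) {a : ℝ} (ha : a ∈ Set.Ico (0 : ℝ) 1)
    (hgrow : ∀ t, phi ε a / (a - 1) ≤ t → t ≤ 1 →
      logNorm f t + n * Real.log 2 * (1 - a) * (t - phi ε a / (a - 1))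
        ≤ logNorm f (phi ε a / (a - 1))) :
    lqNorm 2 (noise ε f) ≤ lqNorm ((a - 1) / phi ε a) f := by
  obtain ⟨r, hr1, -, hc, hM⟩ := exists_supporting_exponent (corr_nonneg h0 h1) (corr_le_half ε) ha
  change 0 ≤ phi ε a + (1 - a) / r at hc
  have hr : 0 < r := by linarith
  have ha1 : 0 < 1 - a := by linarith [ha.2]
  have ha2 : a - 1 ≠ 0 := by linarith
  have hrs : phi ε a / (a - 1) ≤ 1 / r := by
    rw [← neg_div_neg_eq, neg_sub, div_le_iff₀ ha1, one_div_mul_eq_div]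
    linarith
  -- Growth is used at `1/r` alone; `r` is not explicit in the hypothesis, so growth is assumed on
  -- all of `[s₀, 1]`.
  have hg := hgrow (1 / r) hrs (by rw [div_le_one hr]; exact hr1)
  have h := lqNorm_noise_le h0 h1 hr hM f
  refine h.trans ?_
  have hpr := lqNorm_pos hf r
  have hpk := lqNorm_pos hf ((a - 1) / phi ε a)
  rw [← Real.log_le_log_iff (by positivity) hpk, Real.log_mul (Real.exp_ne_zero _) hpr.ne',
    Real.log_exp]
  unfold logNorm at hg
  rw [one_div_one_div, one_div_div] at hg
  refine le_trans (le_of_eq ?_) hg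
  rw [add_comm]
  congr 1
  change (n / 2 * ((2 * phi ε a + 1 - 2 / r * a) * Real.log 2 - Real.log 2
    + 2 / r * Real.log 2) : ℝ) = _
  field_simp
  ring

/-- The slope of the chord of `φ_ε` between `a` and `1` is at least one half. -/
lemma half_le_phi_div (h0 : 0 ≤ ε) (h1 : ε ≤ 1 / 2) {a : ℝ} (ha : a ∈ Set.Ico (0 : ℝ) 1) :
    1 / 2 ≤ phi ε a / (a - 1) := by
  have h := Phi_le (corr_nonneg h0 h1) (corr_le_half ε) ha
  rw [← qZero_eq] at h
  have hq : 0 < qZero ε := by linarith [one_le_qZero ε]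
  have ha1 : 0 < 1 - a := by linarith [ha.2]
  refine (one_div_le_one_div_of_le hq (qZero_le_two h0 h1)).trans ?_
  change phi ε a ≤ (a - 1) / qZero ε at h
  have e : 1 / qZero ε * (1 - a) = -((a - 1) / qZero ε) := by ring
  rw [← neg_div_neg_eq (phi ε a), neg_sub, le_div_iff₀ ha1, e]
  linarith

lemma lqNorm_noise_le_kappaOne (h0 : 0 ≤ ε) (h1 : ε ≤ 1 / 2) {n : ℕ} (hn : 1 ≤ n)
    {f : Cube n → ℝ} (hf : f ≠ 0) {x : ℝ}
    (hx : x = ent (fun z => |f z| / lqNorm 1 f) / n) :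
    lqNorm 2 (noise ε f) ≤ lqNorm (kappaOne x ε) f := by
  unfold kappaOne
  split_ifs with hx0
  · exact lqNorm_noise_le_qZero h0 h1 f
  have hn0 : (0 : ℝ) < n := by exact_mod_cast hn
  have hxpos : 0 < x := lt_of_le_of_ne
    (hx ▸ div_nonneg (ent_normalized_nonneg hf) hn0.le) (Ne.symm hx0)
  have hx1 : x ≤ 1 := by
    rw [hx, div_le_one hn0]; exact ent_normalized_le hf
  have hent : ent (fun z => |f z| / lqNorm 1 f) = n * x := by rw [hx]; field_simp
  have ha : 1 - x ∈ Set.Ico (0 : ℝ) 1 := ⟨by linarith, by linarith⟩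
  have h := lqNorm_noise_le_of_growth h0 h1 hf ha (fun t hst ht => by
    have hs : 0 < phi ε (1 - x) / (1 - x - 1) := by linarith [half_le_phi_div h0 h1 ha]
    refine le_trans (le_of_eq ?_) (logNorm_add_ent_le hf hs hst ht)
    rw [hent]
    ring)
  rwa [show 1 - x - 1 = -x by ring] at h

lemma lqNorm_noise_le_renyi (h0 : 0 ≤ ε) (h1 : ε ≤ 1 / 2) {n : ℕ} (hn : 1 ≤ n)
    {f : Cube n → ℝ} (hf : f ≠ 0) {x : ℝ}
    (hx : x = renyiEnt 2 (fun z => f z / lqNorm 1 f) / n) {a : ℝ} (ha : a ∈ Set.Ico (0 : ℝ) 1)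
    (hax : 1 - a - a * phi ε a / (1 - a) = (x + 1) / 2) :
    lqNorm 2 (noise ε f) ≤ lqNorm ((a - 1) / phi ε a) f := by
  have hn0 : (0 : ℝ) < n := by exact_mod_cast hn
  have hl := Real.log_pos one_lt_two
  refine lqNorm_noise_le_of_growth h0 h1 hf ha fun t hst ht => ?_
  have hs2 := half_le_phi_div h0 h1 ha
  have ha1 : 1 - a ≠ 0 := by linarith [ha.2]
  have hs : a * phi ε a / (1 - a) = -(a * (phi ε a / (a - 1))) := by
    rw [← neg_sub 1 a, div_neg]; ring
  rw [hs] at hax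
  set s := phi ε a / (a - 1) with hsd
  -- A failure at `t` makes the slope on `[s, t]` exceed `-(1-a) n log 2`; convexity carries this
  -- bound on to `1`, while `hmono` bounds the drop on `[1/2, s]` by `n log 2 (s - 1/2)`.
  by_contra! hcon
  have hst' : s < t := by
    refine lt_of_le_of_ne hst fun h => ?_
    rw [← h] at hcon
    simp at hcon
  have hren : n * x * Real.log 2 = 2 * (logNorm f (1 / 2) - logNorm f 1) := by
    rw [← renyiEnt_two_mul_log hf, hx]; field_simp
  have hmono := logNorm_add_mono hf (by norm_num) hs2
  have hslope : -(n * Real.log 2 * (1 - a)) < (logNorm f t - logNorm f s) / (t - s) := by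
    rw [lt_div_iff₀ (sub_pos.2 hst')]; linarith
  have hrest : -(n * Real.log 2 * (1 - a)) * (1 - t) ≤ logNorm f 1 - logNorm f t := by
    rcases ht.eq_or_lt with rfl | ht
    · simp
    · have h2 := (convexOn_logNorm hf).slope_mono_adjacent
        (Set.mem_Ioi.2 (by linarith : 0 < s)) (Set.mem_Ioi.2 one_pos) hst' ht
      rw [← le_div_iff₀ (sub_pos.2 ht)]
      exact hslope.le.trans h2
  -- The equation for `a` says `x/2 = (s - 1/2) + (1-a)(1-s)`, the sum of the two bounds, whose
  -- strict form is contradictory.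
  have hx2 : x = 1 - 2 * a + 2 * (a * s) := by linarith
  have hm : n * x * Real.log 2
      = n * Real.log 2 - 2 * (n * Real.log 2 * a) + 2 * (n * Real.log 2 * a * s) := by
    rw [hx2]; ring
  linarith

lemma renyiEnt_two_div_le {n : ℕ} (hn : 1 ≤ n) {f : Cube n → ℝ} (hf : f ≠ 0) :
    renyiEnt 2 (fun z => f z / lqNorm 1 f) / n ≤ 1 := by
  have hn0 : (0 : ℝ) < n := by exact_mod_cast hn
  have hl := Real.log_pos one_lt_two
  rw [div_le_one hn0]
  have h := logNorm_add_mono hf (s := 1 / 2) (t := 1) (by norm_num) (by norm_num)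
  refine le_of_mul_le_mul_right ?_ hl
  rw [renyiEnt_two_mul_log hf]
  linarith

lemma existsUnique_threshold (h0 : 0 ≤ ε) (h1 : ε ≤ 1 / 2) {v : ℝ} (hv : 1 / qZero ε < v)
    (hv1 : v ≤ 1) :
    ∃! a : ℝ, a ∈ Set.Ico (0 : ℝ) 1 ∧ 1 - a - a * phi ε a / (1 - a) = v := by
  have hδ0 := corr_nonneg h0 h1
  -- At `δ = 1/2` one has `q₀ = 1`, and `1/q₀ < v ≤ 1` is impossible.
  have hδ1 : 2 * ε * (1 - ε) < 1 / 2 := by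
    have hq : 0 < qZero ε := by linarith [one_le_qZero ε]
    have := hv.trans_le hv1
    rw [div_lt_one hq, qZero_eq] at this
    linarith
  rw [qZero_eq] at hv
  obtain ⟨a, ha, hav⟩ := threshold_surj hδ0 hδ1.le hv hv1
  refine ⟨a, ⟨ha, hav⟩, fun b hb => ?_⟩
  exact (threshold_strictAnti hδ0 hδ1).injOn hb.1 ha (hb.2.trans hav.symm)

end

end NoisyCube

end

theorem corollary1p5 (n : ℕ) (hn : 1 ≤ n) (ε : ℝ) (hε₀ : 0 ≤ ε) (hε : ε ≤ 1 / 2)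
    (f : NoisyCube.Cube n → ℝ) (hf : f ≠ 0) :
    -- the case of the entropy `Ent`
    (∀ x : ℝ, x = NoisyCube.ent (fun z => |f z| / NoisyCube.lqNorm 1 f) / n →
      NoisyCube.lqNorm 2 (NoisyCube.noise ε f) ≤
        NoisyCube.lqNorm (NoisyCube.kappaOne x ε) f) ∧
    -- the case of the second Rényi entropy
    (∀ x : ℝ, x = NoisyCube.renyiEnt 2 (fun z => f z / NoisyCube.lqNorm 1 f) / n →
      ((x + 1) / 2 ≤ 1 / NoisyCube.qZero ε →
        NoisyCube.lqNorm 2 (NoisyCube.noise ε f) ≤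
          NoisyCube.lqNorm (NoisyCube.qZero ε) f) ∧
      (1 / NoisyCube.qZero ε < (x + 1) / 2 →
        -- `α` is well defined, and the inequality holds with this `α`
        (∃! α : ℝ, α ∈ Set.Ico (0 : ℝ) 1 ∧
          1 - α - α * NoisyCube.phi ε α / (1 - α) = (x + 1) / 2) ∧
        ∀ α ∈ Set.Ico (0 : ℝ) 1,
          1 - α - α * NoisyCube.phi ε α / (1 - α) = (x + 1) / 2 →
            NoisyCube.lqNorm 2 (NoisyCube.noise ε f) ≤
              NoisyCube.lqNorm ((α - 1) / NoisyCube.phi ε α) f)) := by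
  refine ⟨fun x hx => NoisyCube.lqNorm_noise_le_kappaOne hε₀ hε hn hf hx, fun x hx => ⟨fun _ =>
    NoisyCube.lqNorm_noise_le_qZero hε₀ hε f, fun hlt => ⟨?_, fun α hα hαx =>
    NoisyCube.lqNorm_noise_le_renyi hε₀ hε hn hf hx hα hαx⟩⟩⟩
  have hx1 : x ≤ 1 := hx ▸ NoisyCube.renyiEnt_two_div_le hn hf
  exact NoisyCube.existsUnique_threshold hε₀ hε hlt (by linarith)
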